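/- Let $1\le k\le n-1$, and let $J(n,k)\subset\mathbb{R}^n$ be the hypersimplex, the convex hull of the points with exactly $k$ coordinates equal to $1$ and $n-k$ equal to $0$. For a sequence $S\in\{0,1,*\}^n$ write $S(0),S(1)$ for its numbers of $0$'s and $1$'s, and let $F(S)$ be the convex hull of the vertices of $J(n,k)$ that differ from $S$ only where $S$ has a $*$. Every nonempty face is $F(S)$ for a unique $S$ with either $S(0)=n-k,\ S(1)=k$ or $S(0)<n-k,\ S(1)<k$; only such $S$ are used below. Put $v_0=(1,\dots,1,0,\dots,0)$. *Matchings.* Given integers $m_0,m_1\ge 0$, the vertex $v_0$ is matched with $\emptyset$, and $F(S)$ is matched with $F(S')$ if $S'$ arises from $S$ by one of the following rules. Write $R$ for "there is a $1$ to the right of the rightmost $*$ of $S$" and $L$ for "there is a $0$ to the left of the leftmost $*$ of $S$". 1. $S(1)\le k-1$, $R$, and [$S(1)\ne m_1$; or $S(1)=m_1$, $S(0)>m_0$; or $S(1)=m_1$, $S(0)=m_0$, not $L$]: replace the rightmost $1$ with $*$. 2. $S(1)\le k-2$, not $R$, and [$S(1)\ne m_1-1$; or $S(1)=m_1-1$,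 $S(0)>m_0$; or $S(1)=m_1-1$, $S(0)=m_0$, not $L$]: replace the rightmost $*$ with $1$. 3. $S(1)=k-1$, $S(0)\le n-k-1$, not $R$, $L$: replace the leftmost $0$ with $*$. 4. $S(1)=k-1$, $S(0)\le n-k-2$, not $R$, not $L$: replace the leftmost $*$ with $0$. 5. $S(1)=m_1$, $S(0)\le m_0$, $R$, $L$: replace the leftmost $0$ with $*$. 6. $S(1)=m_1$, $S(0)<m_0$, $R$, not $L$: replace the leftmost $*$ with $0$. 7. $S(1)=m_1-1$, $S(0)\le m_0$, not $R$, $L$: replace the leftmost $0$ with $*$. 8. $S(1)=m_1-1$, $S(0)<m_0$, not $R$, not $L$: replace the leftmost $*$ with $0$. 9. $S(1)=k$, $S(0)=n-k$, $F(S)\ne\{v_0\}$: replace the leftmost $0$ and the rightmost $1$ with $*$. 10. $S(1)=k-1$, $S(0)=n-k-1$, not $R$, not $L$: replace the leftmost $*$ with $0$ and the other $*$ with $1$. *Subcomplexes.* Let $K$ be the regular CW complex formed by the nonempty faces of $J(n,k)$, and let $K'$ be a subcomplex (a set of nonempty faces that contains with each face all its nonempty subfaces) that is invariant under the action of $S_n$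 by permuting coordinates. For $0\le i\le n-k-1$ and $0\le j\le k-1$ call $(i,j)$ shaded if the faces $F(S)$ with $S(0)=i$ and $S(1)=j$ are in $K'$, and call the row $j$ full if all $(i,j)$ are shaded. The canonical matching of $K'$ is the one with $m_0=m_1=0$ if no row or every row is full; otherwise $m_1$ is the least $j$ such that row $j$ is full, and $m_0$ is the largest $i$ such that $(i,m_1-1)$ is not shaded. A face in $K'$ is unmatched if it is not $\{v_0\}$ and it is not matched by the canonical matching with a face in $K'$. **Proposition.** Suppose that $K'$ has unmatched faces in a single dimension $d$, i.e. $K'$ has at least one unmatched face and all its unmatched faces have dimension $d$. Then the reduced cellular homology of $K'$ (with integer coefficients, computed for any choice of orientations of the faces from the cellular chain complex extended by $\emptyset$ as a cell of dimension $-1$) is concentrated in degree $d$: $\widetilde H_d(K')\ne 0$ and $\widetilde H_i(K')=0$ for all $i\ne d$. Furthermore, if $d>0$ and $u_d$ is the number of unmatched faces of $K'$, then $\widetilde H_d(K')\cong\mathbb{Z}^{u_d}$. -/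

import Mathlib

open Set Module

noncomputable section

/-! ### Cellular homology of complexes of faces of a convex polytope -/

namespace FaceComplex

variable {E : Type*} [AddCommGroup E] [Module ℝ E] [TopologicalSpace E]

/-- `F` is a (nonempty) face of `P`: either `P` itself, or the intersection of `P` with a
hyperplane such that `P` lies in one of the two closed half-spaces it determines. -/
def IsFace (P F : Set E) : Prop := F.Nonempty ∧ IsExposed ℝ P F

/-- A set `K` of faces of `P` whose open cells form a subcomplex of the regular CW complex formed
by the faces of `P`: with each face, `K` contains all the faces contained in it. -/
structure IsSubcomplex (P : Set E) (K : Set (Set E)) : Prop where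
  isFace : ∀ F ∈ K, IsFace P F
  down_closed : ∀ F ∈ K, ∀ G, IsFace P G → G ⊆ F → G ∈ K

open Classical in
/-- The dimension of a face, where `∅` is a cell of dimension `-1`. -/
def dim (F : Set E) : ℤ := if F = ∅ then -1 else (finrank ℝ (vectorSpan ℝ F) : ℤ)

/-- A choice of orientations: an ordered basis of the direction space of each (face) `F`.
For a vertex, and for `∅`, there is only one (the empty basis). -/
abbrev Orientations (E : Type*) [AddCommGroup E] [Module ℝ E] : Type _ :=
  ∀ F : Set E, Basis (Fin (finrank ℝ (vectorSpan ℝ F))) ℝ (vectorSpan ℝ F)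

/-- For nonempty `σ ⊂ τ`, a vector in the direction space of `τ` that points from some point of
`τ` outside `σ` to a point of `σ`. If `σ` is a facet of `τ`, this is an outward vector. -/
def outward {τ σ : Set E} (h : σ ⊂ τ) (hσ : σ.Nonempty) : vectorSpan ℝ τ :=
  ⟨hσ.some -ᵥ (exists_of_ssubset h).choose,
    vsub_mem_vectorSpan ℝ (h.subset hσ.some_mem) (exists_of_ssubset h).choose_spec.1⟩

open Classical in
/-- The incidence number `[τ : σ]`. For a facet `σ ≠ ∅` of `τ` it is the sign of the ordered basis
(outward vector, oriented basis of `σ`) with respect to the oriented basis of `τ`;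
it is `1` if `τ` is a vertex and `σ = ∅`, and `0` if `σ` is not a face of `τ` of codimension 1. -/
def incidence (o : Orientations E) (τ σ : Set E) : ℤ :=
  if h : σ ⊂ τ ∧ σ.Nonempty ∧ finrank ℝ (vectorSpan ℝ τ) = finrank ℝ (vectorSpan ℝ σ) + 1 then
    ((SignType.sign (((o τ).reindex (finCongr h.2.2)).det
      (Fin.cons (outward h.1 h.2.1)
        (fun j => Submodule.inclusion (vectorSpan_mono ℝ h.1.subset) (o σ j)))) : SignType) : ℤ)
  else if σ = ∅ ∧ dim τ = 0 then 1 else 0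

/-- The cells of dimension `i` of the complex `K`, extended by `∅` as a cell of dimension `-1`. -/
def Cell (K : Set (Set E)) (i : ℤ) : Type _ := {F : Set E // F ∈ insert ∅ K ∧ dim F = i}

/-- The augmented cellular chain group in degree `i`: free abelian on the cells of dimension `i`. -/
abbrev Chain (K : Set (Set E)) (i : ℤ) : Type _ := Cell K i →₀ ℤ

/-- The matrix of incidence numbers as a map `C_i → C_j`; the cellular boundary operator `∂_i` is
the one for `j = i - 1`. (The sums are finite, as a polytope has finitely many faces; see
`finite_cell`.) -/
def boundary (o : Orientations E) (K : Set (Set E)) (i j : ℤ) : Chain K i →ₗ[ℤ] Chain K j :=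
  Finsupp.linearCombination ℤ fun τ : Cell K i =>
    ∑ᶠ σ : Cell K j, Finsupp.single σ (incidence o τ.1 σ.1)

/-- The reduced cellular homology `ker ∂_i / im ∂_{i+1}` of `K`. -/
abbrev ReducedHomology (o : Orientations E) (K : Set (Set E)) (i : ℤ) : Type _ :=
  LinearMap.ker (boundary o K i (i - 1)) ⧸
    (LinearMap.range (boundary o K (i + 1) i)).submoduleOf
      (LinearMap.ker (boundary o K i (i - 1)))

/-- The reduced homology is nonzero in degree `d`, and zero in all other degrees. -/
def HomologyConcentratedIn (o : Orientations E) (K : Set (Set E)) (d : ℤ) : Prop :=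
  Nontrivial (ReducedHomology o K d) ∧ ∀ i : ℤ, i ≠ d → Subsingleton (ReducedHomology o K i)

end FaceComplex

/-! ### The hypersimplex, its faces and the matchings -/

namespace Hypersimplex

open FaceComplex

/-- The points of `ℝⁿ` with exactly `k` coordinates `1` and `n - k` coordinates `0`. -/
def points (n k : ℕ) : Set (Fin n → ℝ) := {x | (∀ i, x i = 0 ∨ x i = 1) ∧ ∑ i, x i = (k : ℝ)}

/-- The hypersimplex `J(n,k)`. -/
def J (n k : ℕ) : Set (Fin n → ℝ) := convexHull ℝ (points n k)

inductive Letter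
  | zero
  | one
  | star

/-- Sequences of length `n` made up of `0`, `1` and `*`. -/
abbrev Word (n : ℕ) : Type := Fin n → Letter

variable {n : ℕ}

/-- The number of times that a letter occurs in a sequence. -/
def count (S : Word n) (a : Letter) : ℕ := {i | S i = a}.ncard

/-- `F(S)`: the convex hull of the vertices of `J(n,k)` that differ from `S` only where `S`
has a `*`. -/
def face (k : ℕ) (S : Word n) : Set (Fin n → ℝ) :=
  convexHull ℝ {x ∈ points n k | ∀ i, (S i = .zero → x i = 0) ∧ (S i = .one → x i = 1)}

/-- The sequences in normal form: either `S` has no `*` and denotes a vertex, or `S` has fewer than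
`k` ones and fewer than `n - k` zeros, so that none of its `*`s is redundant. Every nonempty face of
`J(n,k)` is `F(S)` for exactly one such `S`. -/
def IsFaceWord (k : ℕ) (S : Word n) : Prop :=
  (count S .one = k ∧ count S .zero + k = n) ∨ (count S .one < k ∧ count S .zero + k < n)

/-- The vertex `v₀ = (1,…,1,0,…,0)`, as a sequence. -/
def v₀ (n k : ℕ) : Word n := fun i => if (i : ℕ) < k then .one else .zero

/-- There is a `1` to the right of the rightmost `*`. -/
def OneRight (S : Word n) : Prop := ∃ i, S i = .one ∧ ∀ j, S j = .star → j < i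

/-- There is a `0` to the left of the leftmost `*`. -/
def ZeroLeft (S : Word n) : Prop := ∃ i, S i = .zero ∧ ∀ j, S j = .star → i < j

/-- `S'` is obtained from `S` by replacing the rightmost letter `a` with `b`. -/
def ReplaceRightmost (a b : Letter) (S S' : Word n) : Prop :=
  ∃ i, IsGreatest {j | S j = a} i ∧ S' = Function.update S i b

/-- `S'` is obtained from `S` by replacing the leftmost letter `a` with `b`. -/
def ReplaceLeftmost (a b : Letter) (S S' : Word n) : Prop :=
  ∃ i, IsLeast {j | S j = a} i ∧ S' = Function.update S i b

/-- The ten rules of the matching with parameters `m₀`, `m₁`: `F(S)` is matched with `F(S')`. -/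
inductive Rule (k m₀ m₁ : ℕ) (S S' : Word n) : Prop
  | r1 (h : count S .one + 1 ≤ k) (hr : OneRight S)
      (hm : count S .one ≠ m₁ ∨ (count S .one = m₁ ∧ m₀ < count S .zero) ∨
        (count S .one = m₁ ∧ count S .zero = m₀ ∧ ¬ ZeroLeft S))
      (hS : ReplaceRightmost .one .star S S')
  | r2 (h : count S .one + 2 ≤ k) (hr : ¬ OneRight S)
      (hm : count S .one + 1 ≠ m₁ ∨ (count S .one + 1 = m₁ ∧ m₀ < count S .zero) ∨
        (count S .one + 1 = m₁ ∧ count S .zero = m₀ ∧ ¬ ZeroLeft S))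
      (hS : ReplaceRightmost .star .one S S')
  | r3 (h : count S .one + 1 = k) (h0 : count S .zero + k + 1 ≤ n)
      (hr : ¬ OneRight S) (hl : ZeroLeft S) (hS : ReplaceLeftmost .zero .star S S')
  | r4 (h : count S .one + 1 = k) (h0 : count S .zero + k + 2 ≤ n)
      (hr : ¬ OneRight S) (hl : ¬ ZeroLeft S) (hS : ReplaceLeftmost .star .zero S S')
  | r5 (h : count S .one = m₁) (h0 : count S .zero ≤ m₀)
      (hr : OneRight S) (hl : ZeroLeft S) (hS : ReplaceLeftmost .zero .star S S')
  | r6 (h : count S .one = m₁) (h0 : count S .zero < m₀)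
      (hr : OneRight S) (hl : ¬ ZeroLeft S) (hS : ReplaceLeftmost .star .zero S S')
  | r7 (h : count S .one + 1 = m₁) (h0 : count S .zero ≤ m₀)
      (hr : ¬ OneRight S) (hl : ZeroLeft S) (hS : ReplaceLeftmost .zero .star S S')
  | r8 (h : count S .one + 1 = m₁) (h0 : count S .zero < m₀)
      (hr : ¬ OneRight S) (hl : ¬ ZeroLeft S) (hS : ReplaceLeftmost .star .zero S S')
  | r9 (h : count S .one = k) (h0 : count S .zero + k = n) (hv : S ≠ v₀ n k)
      (hS : ∃ T, ReplaceLeftmost .zero .star S T ∧ ReplaceRightmost .one .star T S')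
  | r10 (h : count S .one + 1 = k) (h0 : count S .zero + k + 1 = n)
      (hr : ¬ OneRight S) (hl : ¬ ZeroLeft S)
      (hS : ∃ T, ReplaceLeftmost .star .zero S T ∧ ReplaceRightmost .star .one T S')

/-- The face `F` is matched with the face `G`. -/
def MatchedWith (k m₀ m₁ : ℕ) (F G : Set (Fin n → ℝ)) : Prop :=
  ∃ S S' : Word n, IsFaceWord k S ∧ IsFaceWord k S' ∧ F = face k S ∧ G = face k S' ∧
    Rule k m₀ m₁ S S'

/-- `K` is invariant under the action of `S_n` by permutations of the coordinates. -/
def IsInvariant (K : Set (Set (Fin n → ℝ))) : Prop :=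
  ∀ g : Equiv.Perm (Fin n), ∀ F ∈ K, (fun x => x ∘ g) '' F ∈ K

/-- The square labelled `(i, j)` of the subcomplex diagram is shaded: the faces `F(S)` with
`S(0) = i` and `S(1) = j` are in `K`. (Squares have `0 ≤ i ≤ n-k-1` and `0 ≤ j ≤ k-1`. The square
above it has label `(i, j-1)`, the square to its right has label `(i-1, j)`.) -/
def Shaded (k : ℕ) (K : Set (Set (Fin n → ℝ))) (i j : ℕ) : Prop :=
  ∀ S : Word n, count S .zero = i → count S .one = j → face k S ∈ K

/-- The row of squares labelled `(·, j)` is completely shaded. -/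
def RowShaded (k : ℕ) (K : Set (Set (Fin n → ℝ))) (j : ℕ) : Prop :=
  ∀ i, i + k < n → Shaded k K i j

/-- `(m₀, m₁)` are the parameters of the canonical matching of `K`: both are `0` if no row or every
row is completely shaded. Otherwise `(m₀, m₁)` is the label of the leftmost square of the highest
completely shaded row such that the square above it is not shaded. -/
def IsCanonical (k : ℕ) (K : Set (Set (Fin n → ℝ))) (m₀ m₁ : ℕ) : Prop :=
  (((∀ j < k, ¬ RowShaded k K j) ∨ ∀ j < k, RowShaded k K j) ∧ m₀ = 0 ∧ m₁ = 0) ∨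
  (¬ ((∀ j < k, ¬ RowShaded k K j) ∨ ∀ j < k, RowShaded k K j) ∧
    IsLeast {j | j < k ∧ RowShaded k K j} m₁ ∧
    IsGreatest {i | i + k < n ∧ ¬ Shaded k K i (m₁ - 1)} m₀)

/-- The unmatched faces of `K`: those other than `v₀` (which is matched with `∅`) that are not
matched with a face in `K`. -/
def unmatched (k m₀ m₁ : ℕ) (K : Set (Set (Fin n → ℝ))) : Set (Set (Fin n → ℝ)) :=
  {F ∈ K | F ≠ face k (v₀ n k) ∧ ∀ G ∈ K, ¬ MatchedWith k m₀ m₁ F G}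

/-- There are unmatched faces, and all of them have dimension `d`. -/
def UnmatchedInSingleDim (k m₀ m₁ : ℕ) (K : Set (Set (Fin n → ℝ))) (d : ℕ) : Prop :=
  (unmatched k m₀ m₁ K).Nonempty ∧ ∀ F ∈ unmatched k m₀ m₁ K, dim F = d

theorem finite_points (n k : ℕ) : (points n k).Finite := by
  refine (Set.Finite.pi' (t := fun _ : Fin n => ({0, 1} : Set ℝ)) fun _ => by simp).subset ?_
  intro x hx i
  simpa using hx.1 i

/-- `J(n,k)` has finitely many faces. -/
theorem finite_faces (n k : ℕ) : {F | IsFace (J n k) F}.Finite := by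
  have hc : IsCompact (J n k) := (finite_points n k).isCompact_convexHull (𝕜 := ℝ)
  have key : ∀ F, IsFace (J n k) F →
      closure (convexHull ℝ (F.extremePoints ℝ)) = F ∧ F.extremePoints ℝ ⊆ points n k := by
    intro F hF
    refine ⟨closure_convexHull_extremePoints (hF.2.isCompact hc)
      (hF.2.convex (convex_convexHull ℝ _)), ?_⟩
    exact (hF.2.isExtreme.extremePoints_subset_extremePoints).trans
      (extremePoints_convexHull_subset (𝕜 := ℝ))
  refine Set.Finite.of_finite_image (f := fun F => F.extremePoints ℝ) ?_ ?_
  · refine (finite_points n k).finite_subsets.subset ?_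
    rintro _ ⟨F, hF, rfl⟩
    exact (key F hF).2
  · intro F hF G hG h
    rw [← (key F hF).1, ← (key G hG).1]
    exact congrArg (fun A => closure (convexHull ℝ A)) h

theorem finite_cell {k : ℕ} {K : Set (Set (Fin n → ℝ))} (hK : IsSubcomplex (J n k) K) (i : ℤ) :
    Finite (Cell K i) :=
  (((finite_faces n k).subset hK.isFace).insert ∅ |>.subset fun _ h => h.1 :
    {F | F ∈ insert ∅ K ∧ dim F = i}.Finite).to_subtype

end Hypersimplex

end

/-! The argument is discrete Morse theory, carried out on the chain level. For every `m₁ < k` the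
rules form an acyclic matching of the faces of `K` together with `∅`. Let `A` be the set of smaller
cells and `B` the set of larger cells of the matched pairs. Since incidence numbers within pairs are
`±1` and a rank drops along gradient paths, two facts follow. A chain supported on `B` whose
boundary vanishes on `A` is zero (`eq_zero_of_boundary`), and every chain becomes zero on `A` after
subtracting the boundary of a chain supported on `B` (`exists_reduction`). If all unmatched cells
have dimension `d`, every homology class of degree `d` is represented by exactly one cycle vanishing
on `A`, and such a cycle is determined by its values on the unmatched cells, which can be arbitrary.
In other degrees a cycle reduced in this way lives on `B`, hence is zero.

The geometric input is `∂∂ = 0`. A codimension-two pair has exactly two faces in between (`isThin`),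
and these contribute opposite signs, because the two orientation frames differ by a transposition
(`incidence_diamond`).

The combinatorial input concerns words. Let `q` be the first position whose letter is not `1` and
`p` the last position whose letter is not `0`. Conditions `R` and `L` can be read off from the
letters at `p` and `q`, and every rule changes only these letters; hence the rules define an
involution (`Rule.symm_and_up`). Passing from a smaller cell to its partner keeps `q` and `p`, and
passing to another facet can only shrink the interval from `q` to `p`. If the interval does not
shrink, the step goes from a word with no `*` at either end to one with a `*` at some end
(`rank_lt`). Invariance under permutations serves to place `v₀` in `K`, so that `∅` has a partner.
-/

namespace FaceComplex

/-! ### Determinants of frames with a prescribed first vector -/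

section Determinants

variable {V : Type*} [AddCommGroup V] [Module ℝ V] {m : ℕ}

theorem linearIndependent_cons_of_functional {s : Fin m → V}
    (hs : LinearIndependent ℝ s) {f : V →ₗ[ℝ] ℝ} (hf : ∀ i, f (s i) = 0) {w : V} (hw : f w ≠ 0) :
    LinearIndependent ℝ (Fin.cons w s : Fin (m + 1) → V) := by
  rw [linearIndependent_finCons]
  refine ⟨hs, fun h => hw ?_⟩
  have : Submodule.span ℝ (range s) ≤ LinearMap.ker f := by
    rw [Submodule.span_le]
    rintro _ ⟨i, rfl⟩
    exact hf i
  exact this h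

theorem det_cons_ne_zero (B : Basis (Fin (m + 1)) ℝ V) {s : Fin m → V}
    (hs : LinearIndependent ℝ s) {f : V →ₗ[ℝ] ℝ} (hf : ∀ i, f (s i) = 0) {w : V} (hw : f w ≠ 0) :
    B.det (Fin.cons w s : Fin (m + 1) → V) ≠ 0 := by
  have hli := linearIndependent_cons_of_functional hs hf hw
  have hc : Fintype.card (Fin (m + 1)) = finrank ℝ V := by
    rw [Module.finrank_eq_card_basis B]
  let b := basisOfLinearIndependentOfCardEqFinrank hli hc
  have hb : (b : Fin (m + 1) → V) = Fin.cons w s :=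
    coe_basisOfLinearIndependentOfCardEqFinrank hli hc
  rw [← hb]
  exact (B.isUnit_det b).ne_zero

/-- The orientation sign of `(w, s)` depends only on the side of the hyperplane spanned by `s`
on which `w` lies. -/
theorem sign_det_cons_eq (B : Basis (Fin (m + 1)) ℝ V) {s : Fin m → V}
    (hs : LinearIndependent ℝ s) {f : V →ₗ[ℝ] ℝ} (hf : ∀ i, f (s i) = 0) {w w' : V}
    (hw : 0 < f w) (hw' : 0 < f w') :
    SignType.sign (B.det (Fin.cons w s : Fin (m + 1) → V)) =
      SignType.sign (B.det (Fin.cons w' s : Fin (m + 1) → V)) := by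
  have hli := linearIndependent_cons_of_functional hs hf hw.ne'
  have hc : Fintype.card (Fin (m + 1)) = finrank ℝ V := by
    rw [Module.finrank_eq_card_basis B]
  have : FiniteDimensional ℝ V := Module.Finite.of_basis B
  have htop := hli.span_eq_top_of_card_eq_finrank' hc
  have hmem : w' ∈ Submodule.span ℝ (range (Fin.cons w s : Fin (m + 1) → V)) := by
    rw [htop]; trivial
  rw [Fin.range_cons, Submodule.mem_span_insert] at hmem
  obtain ⟨a, z, hz, rfl⟩ := hmem
  have hz0 : f z = 0 := by
    have : Submodule.span ℝ (range s) ≤ LinearMap.ker f := by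
      rw [Submodule.span_le]
      rintro _ ⟨i, rfl⟩
      exact hf i
    exact this hz
  have ha : 0 < a := by
    rw [map_add, map_smul, hz0, add_zero, smul_eq_mul] at hw'
    exact (pos_iff_pos_of_mul_pos hw').2 hw
  -- As a linear function of the first vector, the determinant kills the span of `s`. Hence its
  -- value at `a • w + z` is `a` times its value at `w`, and `f` shows that `a > 0`.
  let D : V →ₗ[ℝ] ℝ :=
    { toFun := fun v => B.det (Fin.cons v s : Fin (m + 1) → V)
      map_add' := fun x y => by
        have := (B.det.curryLeft.map_add x y)
        exact congrArg (fun g => g s) this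
      map_smul' := fun c x => by
        have := (B.det.curryLeft.map_smul c x)
        exact congrArg (fun g => g s) this }
  have hD0 : D z = 0 := by
    have : Submodule.span ℝ (range s) ≤ LinearMap.ker D := by
      rw [Submodule.span_le]
      rintro _ ⟨i, rfl⟩
      refine B.det.map_eq_zero_of_eq _ (i := 0) (j := i.succ) ?_ (Fin.succ_ne_zero i).symm
      simp
    exact this hz
  have hD : D (a • w + z) = a * D w := by rw [map_add, map_smul, hD0, add_zero, smul_eq_mul]
  change SignType.sign (D w) = SignType.sign (D (a • w + z))
  rw [hD, sign_mul, sign_pos ha, one_mul]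

/-- With `u` fixed, the left side is an alternating form in `m` vectors of the `m`-dimensional space
`U`, hence a multiple of `b.det`; evaluating at `b` gives the factor. This merges a product of two
incidence numbers into a single determinant. -/
theorem det_cons_eq_mul (B : Basis (Fin (m + 1)) ℝ V) {U : Type*} [AddCommGroup U] [Module ℝ U]
    (ι : U →ₗ[ℝ] V) (b : Basis (Fin m) ℝ U) (u : V) (x : Fin m → U) :
    B.det (Fin.cons u (fun j => ι (x j)) : Fin (m + 1) → V) =
      B.det (Fin.cons u (fun j => ι (b j)) : Fin (m + 1) → V) * b.det x := by
  have h := ((B.det.curryLeft u).compLinearMap ι).eq_smul_basis_det b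
  exact congrArg (fun g => g x) h

theorem det_cons_cons_swap (B : Basis (Fin (m + 2)) ℝ V) (u v : V) (s : Fin m → V) :
    B.det (Fin.cons u (Fin.cons v s : Fin (m + 1) → V) : Fin (m + 2) → V) =
      -B.det (Fin.cons v (Fin.cons u s : Fin (m + 1) → V) : Fin (m + 2) → V) := by
  rw [← B.det.map_swap _ (i := 0) (j := 1) (by simp)]
  congr 1
  ext i
  refine Fin.cases ?_ (fun i => Fin.cases ?_ (fun i => ?_) i) i
  · simp
  · simp
  · have h1 : (i.succ.succ : Fin (m + 2)) ≠ 0 := Fin.succ_ne_zero _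
    have h2 : (i.succ.succ : Fin (m + 2)) ≠ 1 := by
      rw [← Fin.succ_zero_eq_one, Ne, Fin.succ_inj]; exact Fin.succ_ne_zero _
    simp [Equiv.swap_apply_of_ne_of_ne h1 h2]

end Determinants

/-! ### Incidence numbers and their signs -/

section Incidence

variable {E : Type*} [AddCommGroup E] [Module ℝ E]

/-- `σ` is the set of points of `τ` at which the linear functional `f` attains its maximum. -/
def Supports (f : E →ₗ[ℝ] ℝ) (τ σ : Set E) : Prop :=
  ∃ c, (∀ x ∈ τ, f x ≤ c) ∧ ∀ x ∈ τ, f x = c ↔ x ∈ σ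

/-- The functional exposing `σ` in `P` works for every other face `τ` as well. It supplies the
linear form that separates `τ` from the hyperplane through a facet. -/
theorem exists_supports [TopologicalSpace E] {P σ τ : Set E} (hσ : IsFace P σ) (hτ : IsFace P τ) :
    ∃ f : E →ₗ[ℝ] ℝ, Supports f τ σ := by
  obtain ⟨l, hl⟩ := hσ.2 hσ.1
  have hτP : τ ⊆ P := hτ.2.subset
  obtain ⟨p, hp⟩ := hσ.1
  have hp' := hp
  rw [hl] at hp'
  refine ⟨l, l p, fun x hx => hp'.2 x (hτP hx), fun x hx => ⟨fun hxp => ?_, fun hxσ => ?_⟩⟩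
  · rw [hl]
    exact ⟨hτP hx, fun y hy => (hp'.2 y hy).trans hxp.ge⟩
  · rw [hl] at hxσ
    exact le_antisymm (hp'.2 x (hτP hx)) (hxσ.2 p hp'.1)

theorem Supports.eq_zero_of_mem_vectorSpan {f : E →ₗ[ℝ] ℝ} {τ σ : Set E} (h : Supports f τ σ)
    (hστ : σ ⊆ τ) {v : E} (hv : v ∈ vectorSpan ℝ σ) : f v = 0 := by
  obtain ⟨c, -, hc⟩ := h
  have : vectorSpan ℝ σ ≤ LinearMap.ker f := by
    rw [vectorSpan_def, Submodule.span_le]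
    rintro _ ⟨x, hx, y, hy, rfl⟩
    simp [(hc x (hστ hx)).2 hx, (hc y (hστ hy)).2 hy]
  exact this hv

theorem Supports.sub_pos {f : E →ₗ[ℝ] ℝ} {τ σ : Set E} (h : Supports f τ σ) (hστ : σ ⊆ τ)
    {p q : E} (hp : p ∈ σ) (hq : q ∈ τ) (hqσ : q ∉ σ) : 0 < f (p - q) := by
  obtain ⟨c, hle, hc⟩ := h
  rw [map_sub, (hc p (hστ hp)).2 hp, _root_.sub_pos]
  exact lt_of_le_of_ne (hle q hq) fun h => hqσ ((hc q hq).1 h)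

variable (o : Orientations E) {m : ℕ}

/-- The basis of the direction space of a facet `σ` of `τ`, preceded by the vector `p - q`. -/
noncomputable def facetFrame {τ σ : Set E} (hστ : σ ⊆ τ) (hm : finrank ℝ (vectorSpan ℝ σ) = m) {p q : E}
    (hp : p ∈ σ) (hq : q ∈ τ) : Fin (m + 1) → vectorSpan ℝ τ :=
  Fin.cons ⟨p - q, vsub_mem_vectorSpan ℝ (hστ hp) hq⟩
    fun j => Submodule.inclusion (vectorSpan_mono ℝ hστ) ((o σ).reindex (finCongr hm) j)

/-- The definition of `incidence` relies on arbitrarily chosen points. A supporting functional is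
positive on every vector from `τ \ σ` to `σ`, so by `sign_det_cons_eq` any other choice gives the
same sign. This freedom is what makes the frames in `incidence_diamond` comparable. -/
theorem incidence_eq_sign {τ σ : Set E} {f : E →ₗ[ℝ] ℝ} (hf : Supports f τ σ)
    (hστ : σ ⊂ τ) (hm : finrank ℝ (vectorSpan ℝ σ) = m)
    (hτ : finrank ℝ (vectorSpan ℝ τ) = m + 1) {p q : E} (hp : p ∈ σ) (hq : q ∈ τ) (hqσ : q ∉ σ) :
    incidence o τ σ = ((SignType.sign (((o τ).reindex (finCongr hτ)).det
      (facetFrame o hστ.subset hm hp hq)) : SignType) : ℤ) := by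
  subst hm
  rw [incidence, dif_pos ⟨hστ, ⟨p, hp⟩, hτ⟩]
  congr 1
  have hs : LinearIndependent ℝ fun j =>
      Submodule.inclusion (vectorSpan_mono ℝ hστ.subset) (o σ j) :=
    (o σ).linearIndependent.map' _ (Submodule.ker_inclusion _ _ _)
  have hσ : σ.Nonempty := ⟨p, hp⟩
  have h := sign_det_cons_eq ((o τ).reindex (finCongr hτ)) hs
    (f := f ∘ₗ (vectorSpan ℝ τ).subtype) (w := outward hστ hσ)
    (w' := ⟨p - q, vsub_mem_vectorSpan ℝ (hστ.subset hp) hq⟩)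
    (fun i => hf.eq_zero_of_mem_vectorSpan hστ.subset (o σ i).2)
    (hf.sub_pos hστ.subset hσ.some_mem (exists_of_ssubset hστ).choose_spec.1
      (exists_of_ssubset hστ).choose_spec.2)
    (hf.sub_pos hστ.subset hp hq hqσ)
  rw [h, facetFrame]
  congr 2
  simp

theorem det_facetFrame_ne_zero {τ σ : Set E} {f : E →ₗ[ℝ] ℝ} (hf : Supports f τ σ)
    (hστ : σ ⊆ τ) (hm : finrank ℝ (vectorSpan ℝ σ) = m)
    (B : Basis (Fin (m + 1)) ℝ (vectorSpan ℝ τ)) {p q : E} (hp : p ∈ σ) (hq : q ∈ τ)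
    (hqσ : q ∉ σ) : B.det (facetFrame o hστ hm hp hq) ≠ 0 :=
  det_cons_ne_zero B
    (((o σ).reindex (finCongr hm)).linearIndependent.map' _ (Submodule.ker_inclusion _ _ _))
    (f := f ∘ₗ (vectorSpan ℝ τ).subtype)
    (fun j => hf.eq_zero_of_mem_vectorSpan hστ ((o σ).reindex (finCongr hm) j).2)
    (hf.sub_pos hστ hp hq hqσ).ne'

theorem incidence_mul_self {τ σ : Set E} {f : E →ₗ[ℝ] ℝ}
    (hf : Supports f τ σ) (hστ : σ ⊂ τ) (hσ : σ.Nonempty)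
    (h : finrank ℝ (vectorSpan ℝ τ) = finrank ℝ (vectorSpan ℝ σ) + 1) :
    incidence o τ σ * incidence o τ σ = 1 := by
  obtain ⟨q, hq, hqσ⟩ := exists_of_ssubset hστ
  obtain ⟨p, hp⟩ := hσ
  rw [incidence_eq_sign o hf hστ rfl h hp hq hqσ]
  have := det_facetFrame_ne_zero o hf hστ.subset rfl ((o τ).reindex (finCongr h)) hp hq hqσ
  rcases lt_or_gt_of_ne this with h | h
  · rw [sign_neg h]; rfl
  · rw [sign_pos h]; rfl

/-- In the frame for `τ`, the chosen basis of `σ` can be exchanged for the frame of `σ` built from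
`ρ`; by `det_cons_eq_mul` the cost is exactly the determinant whose sign is the second incidence
number. -/
theorem incidence_mul_incidence {τ σ ρ : Set E} {f g : E →ₗ[ℝ] ℝ}
    (hf : Supports f τ σ) (hg : Supports g σ ρ) (hστ : σ ⊂ τ) (hρσ : ρ ⊂ σ)
    (hm : finrank ℝ (vectorSpan ℝ ρ) = m) (hσ : finrank ℝ (vectorSpan ℝ σ) = m + 1)
    (hτ : finrank ℝ (vectorSpan ℝ τ) = m + 2)
    {p q r : E} (hp : p ∈ ρ) (hq : q ∈ σ) (hqρ : q ∉ ρ) (hr : r ∈ τ) (hrσ : r ∉ σ) :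
    incidence o τ σ * incidence o σ ρ = ((SignType.sign (((o τ).reindex (finCongr hτ)).det
      (Fin.cons ⟨p - r, vsub_mem_vectorSpan ℝ (hστ.subset (hρσ.subset hp)) hr⟩
        (Fin.cons ⟨p - q, vsub_mem_vectorSpan ℝ (hστ.subset (hρσ.subset hp)) (hστ.subset hq)⟩
          fun j => Submodule.inclusion (vectorSpan_mono ℝ (hρσ.trans hστ).subset)
            ((o ρ).reindex (finCongr hm) j)))) : SignType) : ℤ) := by
  rw [incidence_eq_sign o hf hστ hσ hτ (hρσ.subset hp) hr hrσ,
    incidence_eq_sign o hg hρσ hm hσ hp hq hqρ, ← SignType.coe_mul, ← sign_mul]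
  congr 2
  rw [facetFrame, ← det_cons_eq_mul]
  congr 1
  congr 1
  ext1 j
  refine Fin.cases ?_ (fun j => ?_) j
  · rfl
  · rfl

/-- The two ways to pass from a face to a face of codimension two contribute opposite signs. -/
theorem incidence_diamond {τ σ₁ σ₂ ρ : Set E} {f₁ f₂ g₁ g₂ : E →ₗ[ℝ] ℝ}
    (hf₁ : Supports f₁ τ σ₁) (hg₁ : Supports g₁ σ₁ ρ)
    (hf₂ : Supports f₂ τ σ₂) (hg₂ : Supports g₂ σ₂ ρ)
    (h₁τ : σ₁ ⊂ τ) (h₁ρ : ρ ⊂ σ₁) (h₂τ : σ₂ ⊂ τ) (h₂ρ : ρ ⊂ σ₂) (hρ : ρ.Nonempty)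
    (h₁ : finrank ℝ (vectorSpan ℝ σ₁) = finrank ℝ (vectorSpan ℝ ρ) + 1)
    (h₂ : finrank ℝ (vectorSpan ℝ σ₂) = finrank ℝ (vectorSpan ℝ ρ) + 1)
    (hτ : finrank ℝ (vectorSpan ℝ τ) = finrank ℝ (vectorSpan ℝ ρ) + 2)
    (h₁₂ : ¬ σ₁ ⊆ σ₂) (h₂₁ : ¬ σ₂ ⊆ σ₁) :
    incidence o τ σ₁ * incidence o σ₁ ρ + incidence o τ σ₂ * incidence o σ₂ ρ = 0 := by
  obtain ⟨p, hp⟩ := hρ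
  -- Each of `q₁`, `q₂` serves twice: `q₁` lies in `σ₁` outside `ρ` and in `τ` outside `σ₂`, and
  -- symmetrically for `q₂`. The frames obtained via `σ₁` and `σ₂` therefore start with the same two
  -- vectors in opposite order.
  obtain ⟨q₁, hq₁, hq₁'⟩ := not_subset.1 h₁₂
  obtain ⟨q₂, hq₂, hq₂'⟩ := not_subset.1 h₂₁
  rw [incidence_mul_incidence o hf₁ hg₁ h₁τ h₁ρ rfl h₁ hτ hp hq₁ (fun h => hq₁' (h₂ρ.subset h))
      (h₂τ.subset hq₂) hq₂',
    incidence_mul_incidence o hf₂ hg₂ h₂τ h₂ρ rfl h₂ hτ hp hq₂ (fun h => hq₂' (h₁ρ.subset h))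
      (h₁τ.subset hq₁) hq₁', det_cons_cons_swap, Left.sign_neg, SignType.coe_neg]
  exact neg_add_cancel _

/-- The analogue of the diamond relation with `∅` at the bottom: the outward vectors at the two ends
of an edge are negatives of each other. -/
theorem incidence_edge {τ : Set E} {x y : E} {f g : E →ₗ[ℝ] ℝ}
    (hf : Supports f τ {x}) (hg : Supports g τ {y}) (hx : x ∈ τ) (hy : y ∈ τ) (hxy : x ≠ y)
    (hτ : finrank ℝ (vectorSpan ℝ τ) = 1) :
    incidence o τ {x} + incidence o τ {y} = 0 := by
  have hx1 : ({x} : Set E) ⊂ τ := ⟨by simpa using hx, fun h => hxy (by simpa using (h hy).symm)⟩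
  have hy1 : ({y} : Set E) ⊂ τ := ⟨by simpa using hy, fun h => hxy (by simpa using (h hx))⟩
  have h0 : ∀ z : E, finrank ℝ (vectorSpan ℝ {z}) = 0 := fun z => by
    rw [vectorSpan_singleton]; simp
  rw [incidence_eq_sign o hf hx1 (h0 x) hτ (mem_singleton x) hy (by simpa using hxy.symm),
    incidence_eq_sign o hg hy1 (h0 y) hτ (mem_singleton y) hx (by simpa using hxy)]
  have : facetFrame o hx1.subset (h0 x) (mem_singleton x) hy =
      fun i => (-1 : Fin 1 → ℝ) i • facetFrame o hy1.subset (h0 y) (mem_singleton y) hx i := by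
    ext i
    obtain rfl : i = 0 := Fin.fin_one_eq_zero i
    simp [facetFrame]
  rw [this, AlternatingMap.map_smul_univ]
  simp [Left.sign_neg]

end Incidence

/-! ### The boundary operator squares to zero -/

section Boundary

variable {E : Type*} [AddCommGroup E] [Module ℝ E]

theorem dim_empty : dim (∅ : Set E) = -1 := if_pos rfl

theorem dim_of_nonempty {F : Set E} (hF : F.Nonempty) :
    dim F = (finrank ℝ (vectorSpan ℝ F) : ℤ) := if_neg hF.ne_empty

theorem nonempty_of_dim {F : Set E} (h : 0 ≤ dim F) : F.Nonempty := by
  by_contra hF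
  rw [not_nonempty_iff_eq_empty] at hF
  rw [hF, dim_empty] at h
  omega

variable (o : Orientations E)

theorem of_incidence_ne_zero {τ σ : Set E} (h : incidence o τ σ ≠ 0) :
    (σ ⊂ τ ∧ σ.Nonempty ∧ finrank ℝ (vectorSpan ℝ τ) = finrank ℝ (vectorSpan ℝ σ) + 1) ∨
      (σ = ∅ ∧ dim τ = 0) := by
  unfold incidence at h
  split_ifs at h with h1 h2
  · exact Or.inl h1
  · exact Or.inr h2
  · exact absurd rfl h

theorem incidence_empty {τ : Set E} (h : dim τ = 0) : incidence o τ ∅ = 1 := by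
  unfold incidence
  rw [dif_neg (by simp), if_pos ⟨rfl, h⟩]

theorem Cell.ext {K : Set (Set E)} {i : ℤ} {σ τ : Cell K i} (h : σ.1 = τ.1) : σ = τ :=
  Subtype.ext h

theorem Cell.mem_of_nonempty {K : Set (Set E)} {i : ℤ} (σ : Cell K i) (h : σ.1.Nonempty) :
    σ.1 ∈ K := σ.2.1.resolve_left h.ne_empty

variable {K : Set (Set E)}

theorem boundary_single {i j : ℤ} [Finite (Cell K j)] (τ : Cell K i) (σ : Cell K j) :
    boundary o K i j (Finsupp.single τ 1) σ = incidence o τ.1 σ.1 := by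
  classical
  have := Fintype.ofFinite (Cell K j)
  rw [boundary, Finsupp.linearCombination_single, one_smul, finsum_eq_sum_of_fintype,
    Finsupp.finsetSum_apply]
  simp [Finsupp.single_apply]

theorem boundary_apply {i j : ℤ} [Fintype (Cell K i)] [Finite (Cell K j)] (x : Chain K i)
    (σ : Cell K j) : boundary o K i j x σ = ∑ τ, x τ * incidence o τ.1 σ.1 := by
  classical
  conv_lhs => rw [← Finsupp.univ_sum_single x]
  rw [map_sum, Finsupp.finsetSum_apply]
  refine Finset.sum_congr rfl fun τ _ => ?_
  rw [← boundary_single o τ σ, ← mul_one (x τ), ← smul_eq_mul, ← Finsupp.smul_single, map_smul]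
  simp

/-- Every interval of length two of the face poset of `K`, extended by `∅`, has exactly two
elements in the middle. -/
structure IsThin (K : Set (Set E)) : Prop where
  diamond : ∀ τ ∈ K, ∀ ρ ∈ K, ρ ⊂ τ →
    finrank ℝ (vectorSpan ℝ τ) = finrank ℝ (vectorSpan ℝ ρ) + 2 →
    ∃ σ₁ ∈ K, ∃ σ₂ ∈ K, (ρ ⊂ σ₁ ∧ σ₁ ⊂ τ ∧
        finrank ℝ (vectorSpan ℝ σ₁) = finrank ℝ (vectorSpan ℝ ρ) + 1) ∧
      (ρ ⊂ σ₂ ∧ σ₂ ⊂ τ ∧ finrank ℝ (vectorSpan ℝ σ₂) = finrank ℝ (vectorSpan ℝ ρ) + 1) ∧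
      ¬ σ₁ ⊆ σ₂ ∧ ¬ σ₂ ⊆ σ₁ ∧
      ∀ σ ∈ K, ρ ⊂ σ → σ ⊂ τ → finrank ℝ (vectorSpan ℝ σ) = finrank ℝ (vectorSpan ℝ ρ) + 1 →
        σ = σ₁ ∨ σ = σ₂
  edge : ∀ τ ∈ K, finrank ℝ (vectorSpan ℝ τ) = 1 →
    ∃ x y : E, x ≠ y ∧ {x} ∈ K ∧ {y} ∈ K ∧ x ∈ τ ∧ y ∈ τ ∧
      ∀ σ ∈ K, σ ⊂ τ → finrank ℝ (vectorSpan ℝ σ) = 0 → σ = {x} ∨ σ = {y}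

/-- No relation between `i`, `j`, `l` is needed, since a single nonzero term already forces them to
be consecutive. Thinness then leaves exactly two terms, which cancel by `incidence_diamond`, or by
`incidence_edge` if `ρ` is `∅`. -/
theorem sum_incidence_mul_incidence [TopologicalSpace E] {P : Set E} (hK : IsSubcomplex P K) (hthin : IsThin K)
    {i j l : ℤ} [Fintype (Cell K j)] (τ : Cell K i) (ρ : Cell K l) :
    ∑ σ : Cell K j, incidence o τ.1 σ.1 * incidence o σ.1 ρ.1 = 0 := by
  by_cases hall : ∀ σ : Cell K j, incidence o τ.1 σ.1 * incidence o σ.1 ρ.1 = 0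
  · exact Finset.sum_eq_zero fun σ _ => hall σ
  push Not at hall
  obtain ⟨σ₀, h₀⟩ := hall
  have hdim := σ₀.2.2
  rcases of_incidence_ne_zero o (left_ne_zero_of_mul h₀) with ⟨h1, h1', h1''⟩ | ⟨h1, -⟩
  swap
  · rcases of_incidence_ne_zero o (right_ne_zero_of_mul h₀) with ⟨h2, -⟩ | ⟨-, h2⟩
    · rw [h1] at h2
      exact absurd (empty_subset _) h2.not_subset
    · rw [h1, dim_empty] at h2
      omega
  rw [dim_of_nonempty h1'] at hdim
  have hτK : τ.1 ∈ K := τ.mem_of_nonempty (h1'.mono h1.subset)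
  rcases of_incidence_ne_zero o (right_ne_zero_of_mul h₀) with ⟨h2, h2', h2''⟩ | ⟨h2, h2'⟩
  · have hρK : ρ.1 ∈ K := ρ.mem_of_nonempty h2'
    obtain ⟨σ₁, hσ₁, σ₂, hσ₂, ⟨a1, a2, a3⟩, ⟨b1, b2, b3⟩, c1, c2, hσ⟩ :=
      hthin.diamond τ.1 hτK ρ.1 hρK (h2.trans h1) (by omega)
    let s₁ : Cell K j := ⟨σ₁, mem_insert_of_mem _ hσ₁, by
      rw [dim_of_nonempty (h2'.mono a1.subset), ← hdim]; omega⟩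
    let s₂ : Cell K j := ⟨σ₂, mem_insert_of_mem _ hσ₂, by
      rw [dim_of_nonempty (h2'.mono b1.subset), ← hdim]; omega⟩
    have hne : s₁ ≠ s₂ := fun h => c1 (congrArg Subtype.val h).subset
    rw [Fintype.sum_eq_add s₁ s₂ hne]
    · obtain ⟨f₁, hf₁⟩ := exists_supports (hK.isFace _ hσ₁) (hK.isFace _ hτK)
      obtain ⟨f₂, hf₂⟩ := exists_supports (hK.isFace _ hσ₂) (hK.isFace _ hτK)
      obtain ⟨g₁, hg₁⟩ := exists_supports (hK.isFace _ hρK) (hK.isFace _ hσ₁)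
      obtain ⟨g₂, hg₂⟩ := exists_supports (hK.isFace _ hρK) (hK.isFace _ hσ₂)
      exact incidence_diamond o hf₁ hg₁ hf₂ hg₂ a2 a1 b2 b1 h2' a3 b3 (by omega) c1 c2
    · rintro σ ⟨hn1, hn2⟩
      by_contra h
      rcases of_incidence_ne_zero o (right_ne_zero_of_mul h) with ⟨e1, e1', e1''⟩ | ⟨e1, -⟩
      swap
      · exact h2'.ne_empty e1
      rcases of_incidence_ne_zero o (left_ne_zero_of_mul h) with ⟨e2, e2', e2''⟩ | ⟨e2, -⟩
      swap
      · rw [e2] at e1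
        exact e1.not_subset (empty_subset _)
      rcases hσ σ.1 (σ.mem_of_nonempty e2') e1 e2 e1'' with h | h
      · exact hn1 (Cell.ext h)
      · exact hn2 (Cell.ext h)
  · rw [dim_of_nonempty h1'] at h2'
    obtain ⟨x, y, hxy, hx, hy, hxτ, hyτ, hσ⟩ := hthin.edge τ.1 hτK (by omega)
    have h0 : ∀ z : E, finrank ℝ (vectorSpan ℝ {z}) = 0 := fun z => by
      rw [vectorSpan_singleton]; simp
    have hd : ∀ z : E, dim {z} = 0 := fun z => by
      rw [dim_of_nonempty (singleton_nonempty z), h0]; rfl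
    let s₁ : Cell K j := ⟨{x}, mem_insert_of_mem _ hx, by rw [hd, ← hdim, h2']⟩
    let s₂ : Cell K j := ⟨{y}, mem_insert_of_mem _ hy, by rw [hd, ← hdim, h2']⟩
    have hne : s₁ ≠ s₂ := fun h => hxy (singleton_injective (congrArg Subtype.val h))
    rw [Fintype.sum_eq_add s₁ s₂ hne]
    · obtain ⟨f, hf⟩ := exists_supports (hK.isFace _ hx) (hK.isFace _ hτK)
      obtain ⟨g, hg⟩ := exists_supports (hK.isFace _ hy) (hK.isFace _ hτK)
      rw [h2, incidence_empty o (hd x), incidence_empty o (hd y), mul_one, mul_one]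
      exact incidence_edge o hf hg hxτ hyτ hxy (by omega)
    · rintro σ ⟨hn1, hn2⟩
      by_contra h
      rcases of_incidence_ne_zero o (right_ne_zero_of_mul h) with ⟨-, e1', -⟩ | ⟨-, e1⟩
      · rw [h2] at e1'
        exact Set.not_nonempty_empty e1'
      have hne := nonempty_of_dim e1.ge
      rcases of_incidence_ne_zero o (left_ne_zero_of_mul h) with ⟨e2, e2', e2''⟩ | ⟨e2, -⟩
      swap
      · exact hne.ne_empty e2
      rw [dim_of_nonempty hne] at e1
      rcases hσ σ.1 (σ.mem_of_nonempty e2') e2 (by omega) with h | h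
      · exact hn1 (Cell.ext h)
      · exact hn2 (Cell.ext h)

theorem boundary_boundary [TopologicalSpace E] {P : Set E} (hK : IsSubcomplex P K) (hthin : IsThin K)
    (hfin : ∀ i, Finite (Cell K i)) {i j l : ℤ} (x : Chain K i) :
    boundary o K j l (boundary o K i j x) = 0 := by
  have := fun i => Fintype.ofFinite (Cell K i)
  ext ρ
  rw [boundary_apply]
  simp_rw [boundary_apply, Finset.sum_mul]
  rw [Finset.sum_comm]
  simp_rw [mul_assoc, ← Finset.mul_sum, sum_incidence_mul_incidence o hK hthin, mul_zero]
  simp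

end Boundary

/-! ### Algebraic discrete Morse theory for an acyclic matching -/

section Matching

variable {E : Type*} [AddCommGroup E] [Module ℝ E]

/-- An acyclic matching `μ : A → B` of cells of `K` (and `∅`), where each cell in `A` is a facet of
its partner in `B`; the function `r` strictly decreases along gradient paths. -/
structure IsAcyclicMatching (o : Orientations E) (K A B : Set (Set E)) (μ : Set E → Set E)
    (r : Set E → ℕ) : Prop where
  lower_subset : A ⊆ insert ∅ K
  upper_subset : B ⊆ insert ∅ K
  disjoint : Disjoint A B
  bijOn : BijOn μ A B
  dim_eq : ∀ a ∈ A, dim (μ a) = dim a + 1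
  incidence_sq : ∀ a ∈ A, incidence o (μ a) a * incidence o (μ a) a = 1
  rank_lt : ∀ a ∈ A, ∀ a' ∈ A, a' ≠ a → incidence o (μ a) a' ≠ 0 → r a' < r a

namespace IsAcyclicMatching

variable {o : Orientations E} {K A B : Set (Set E)} {μ : Set E → Set E} {r : Set E → ℕ}

/-- In the support of a nonzero `y`, take the cell `τ` whose partner `a` has maximal rank. Another
support cell with `a` in its boundary would have a partner of larger rank. So the coefficient of
`∂y` at `a` is `±y τ`, which is not zero. -/
theorem eq_zero_of_boundary (h : IsAcyclicMatching o K A B μ r) (hfin : ∀ i, Finite (Cell K i))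
    {i j : ℤ} (hij : i = j + 1) {y : Chain K i} (hy : ∀ τ, τ.1 ∉ B → y τ = 0)
    (hd : ∀ σ : Cell K j, σ.1 ∈ A → boundary o K i j y σ = 0) : y = 0 := by
  have := fun i => Fintype.ofFinite (Cell K i)
  by_contra hne
  have hB : ∀ τ, y τ ≠ 0 → τ.1 ∈ B := fun τ hτ => by
    by_contra hn
    exact hτ (hy τ hn)
  let inv : Set E → Set E := Function.invFunOn μ A
  have hinv : ∀ b ∈ B, inv b ∈ A ∧ μ (inv b) = b := fun b hb =>
    Function.invFunOn_pos (h.bijOn.surjOn hb)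
  obtain ⟨τ, hτ, hmax⟩ := Finset.exists_max_image y.support (fun τ => r (inv τ.1))
    (Finsupp.support_nonempty_iff.2 hne)
  rw [Finsupp.mem_support_iff] at hτ
  obtain ⟨ha, hμ⟩ := hinv _ (hB τ hτ)
  have hdim : dim (inv τ.1) = j := by
    have h1 := h.dim_eq _ ha
    rw [hμ, τ.2.2] at h1
    omega
  let σ : Cell K j := ⟨inv τ.1, h.lower_subset ha, hdim⟩
  have h0 := hd σ ha
  rw [boundary_apply, Finset.sum_eq_single τ] at h0
  · have hsq := h.incidence_sq _ ha
    rw [hμ] at hsq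
    rcases mul_eq_zero.1 h0 with h1 | h1
    · exact hτ h1
    · change incidence o τ.1 (inv τ.1) = 0 at h1
      rw [h1] at hsq
      simp at hsq
  · intro τ' _ hne'
    by_contra h1
    have hτ' := left_ne_zero_of_mul h1
    obtain ⟨ha', hμ'⟩ := hinv _ (hB τ' hτ')
    have h2 := hmax τ' (Finsupp.mem_support_iff.2 hτ')
    refine h2.not_gt (h.rank_lt _ ha' _ ha ?_ ?_)
    · intro heq
      rw [← heq, hμ] at hμ'
      exact hne' (Cell.ext hμ'.symm)
    · rw [hμ']
      exact right_ne_zero_of_mul h1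
  · intro h1
    exact absurd (Finset.mem_univ _) h1

/-- The chains that are congruent, modulo boundaries of chains supported in `B`,
to a chain that vanishes on `A`. -/
def reducible (o : Orientations E) (K A B : Set (Set E)) (i j : ℤ) : Submodule ℤ (Chain K j) where
  carrier := {x | ∃ y : Chain K i, (∀ τ, τ.1 ∉ B → y τ = 0) ∧
    ∀ σ : Cell K j, σ.1 ∈ A → (x - boundary o K i j y) σ = 0}
  add_mem' := by
    rintro x x' ⟨y, hy, hx⟩ ⟨y', hy', hx'⟩
    refine ⟨y + y', fun τ hτ => by simp [hy τ hτ, hy' τ hτ], fun σ hσ => ?_⟩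
    have h1 := hx σ hσ
    have h2 := hx' σ hσ
    rw [map_add, add_sub_add_comm, Finsupp.add_apply, h1, h2, add_zero]
  zero_mem' := ⟨0, by simp, by simp⟩
  smul_mem' := by
    rintro c x ⟨y, hy, hx⟩
    refine ⟨c • y, fun τ hτ => by simp [hy τ hτ], fun σ hσ => ?_⟩
    rw [map_smul, ← smul_sub, Finsupp.smul_apply, hx σ hσ, smul_zero]

/-- By induction on the rank. For `σ` in `A`, the boundary of its partner is reducible, and so are
its terms other than `σ`: they lie outside `A` or have smaller rank. What remains is `±σ`. -/
theorem single_mem_reducible (h : IsAcyclicMatching o K A B μ r) (hfin : ∀ i, Finite (Cell K i))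
    {i j : ℤ} (hij : i = j + 1) : ∀ (n : ℕ) (σ : Cell K j), r σ.1 < n →
      Finsupp.single σ 1 ∈ reducible o K A B i j := by
  have := fun i => Fintype.ofFinite (Cell K i)
  classical
  intro n
  induction n with
  | zero => intro σ hσ; omega
  | succ n ih =>
    intro σ hσ
    by_cases hA : σ.1 ∈ A
    swap
    · refine ⟨0, by simp, fun σ' hσ' => ?_⟩
      have : σ ≠ σ' := fun h => hA (h ▸ hσ')
      simp [this]
    let τ : Cell K i := ⟨μ σ.1, h.upper_subset (h.bijOn.mapsTo hA), by
      rw [h.dim_eq _ hA, σ.2.2, hij]⟩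
    have hmem : boundary o K i j (Finsupp.single τ 1) ∈ reducible o K A B i j := by
      refine ⟨Finsupp.single τ 1, fun τ' hτ' => ?_, by simp⟩
      have : τ ≠ τ' := fun h' => hτ' (h' ▸ h.bijOn.mapsTo hA)
      simp [this]
    have hsum : boundary o K i j (Finsupp.single τ 1) =
        incidence o τ.1 σ.1 • Finsupp.single σ 1 +
          ∑ σ' ∈ Finset.univ.erase σ, incidence o τ.1 σ'.1 • Finsupp.single σ' (1 : ℤ) := by
      rw [Finset.add_sum_erase _ (fun σ' : Cell K j =>
        incidence o τ.1 σ'.1 • Finsupp.single σ' (1 : ℤ)) (Finset.mem_univ σ)]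
      conv_lhs => rw [← Finsupp.univ_sum_single (boundary o K i j (Finsupp.single τ 1))]
      refine Finset.sum_congr rfl fun σ' _ => ?_
      rw [boundary_single, Finsupp.smul_single, smul_eq_mul, mul_one]
    have hrest : ∑ σ' ∈ Finset.univ.erase σ, incidence o τ.1 σ'.1 • Finsupp.single σ' (1 : ℤ) ∈
        reducible o K A B i j := by
      refine Submodule.sum_mem _ fun σ' hσ' => ?_
      have hne : σ' ≠ σ := Finset.ne_of_mem_erase hσ'
      by_cases h0 : incidence o τ.1 σ'.1 = 0
      · rw [h0, zero_smul]; exact Submodule.zero_mem _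
      refine Submodule.smul_mem _ _ ?_
      by_cases hA' : σ'.1 ∈ A
      · have := h.rank_lt _ hA _ hA' (fun h => hne (Cell.ext h)) h0
        exact ih σ' (by omega)
      · refine ⟨0, by simp, fun σ'' hσ'' => ?_⟩
        have : σ' ≠ σ'' := fun h => hA' (h ▸ hσ'')
        simp [this]
    have h1 := Submodule.sub_mem _ hmem hrest
    rw [hsum, add_sub_cancel_right] at h1
    -- The incidence number is its own inverse, so multiplying by it once more isolates `σ` with
    -- coefficient `1`.
    have h2 := Submodule.smul_mem _ (incidence o τ.1 σ.1) h1
    rwa [smul_smul, h.incidence_sq _ hA, one_smul] at h2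

theorem exists_reduction (h : IsAcyclicMatching o K A B μ r) (hfin : ∀ i, Finite (Cell K i))
    {i j : ℤ} (hij : i = j + 1) (x : Chain K j) :
    ∃ y : Chain K i, (∀ τ, τ.1 ∉ B → y τ = 0) ∧
      ∀ σ : Cell K j, σ.1 ∈ A → (x - boundary o K i j y) σ = 0 := by
  have := fun i => Fintype.ofFinite (Cell K i)
  change x ∈ reducible o K A B i j
  rw [← Finsupp.univ_sum_single x]
  refine Submodule.sum_mem _ fun σ _ => ?_
  rw [← mul_one (x σ), ← smul_eq_mul, ← Finsupp.smul_single]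
  exact Submodule.smul_mem _ _ (h.single_mem_reducible hfin hij (r σ.1 + 1) σ (Nat.lt_succ_self _))

/-- A cycle reduced to vanish on `A` is supported on `B`, as there are no unmatched cells in this
degree. Being still a cycle, it is zero by `eq_zero_of_boundary`. -/
theorem subsingleton_reducedHomology (h : IsAcyclicMatching o K A B μ r)
    (hfin : ∀ i, Finite (Cell K i))
    (hdd : ∀ {i j l : ℤ} (x : Chain K i), boundary o K j l (boundary o K i j x) = 0)
    {i : ℤ} (hU : ∀ σ : Cell K i, σ.1 ∈ A ∪ B) : Subsingleton (ReducedHomology o K i) := by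
  rw [Submodule.Quotient.subsingleton_iff, eq_top_iff]
  rintro ⟨z, hz⟩ -
  obtain ⟨y, -, hy⟩ := h.exists_reduction hfin (i := i + 1) rfl z
  have hzero : z - boundary o K (i + 1) i y = 0 := by
    refine h.eq_zero_of_boundary hfin (j := i - 1) (by omega) (fun τ hτ => ?_) fun σ _ => ?_
    · exact hy τ ((hU τ).resolve_right hτ)
    · rw [map_sub, hdd, LinearMap.mem_ker.1 hz, sub_zero]; rfl
  exact ⟨y, (sub_eq_zero.1 hzero).symm⟩

/-- The cycles that vanish on `A`. -/
def normalCycles (o : Orientations E) (K A : Set (Set E)) (d : ℤ) :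
    Submodule ℤ (LinearMap.ker (boundary o K d (d - 1))) where
  carrier := {z | ∀ σ : Cell K d, σ.1 ∈ A → z.1 σ = 0}
  add_mem' := by
    intro x y hx hy σ hσ
    change x.1 σ + y.1 σ = 0
    rw [hx σ hσ, hy σ hσ, add_zero]
  zero_mem' := fun _ _ => rfl
  smul_mem' := by
    intro c x hx σ hσ
    change c • x.1 σ = 0
    rw [hx σ hσ, smul_zero]

/-- If all unmatched cells have dimension `d`, then the homology in degree `d` is isomorphic to the
group of cycles that vanish on `A`. -/
theorem bijective_normalCycles_mkQ (h : IsAcyclicMatching o K A B μ r)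
    (hfin : ∀ i, Finite (Cell K i))
    (hdd : ∀ {i j l : ℤ} (x : Chain K i), boundary o K j l (boundary o K i j x) = 0)
    {d : ℤ} (hU : ∀ σ : Cell K (d + 1), σ.1 ∈ A ∪ B) :
    Function.Bijective (((LinearMap.range (boundary o K (d + 1) d)).submoduleOf
      (LinearMap.ker (boundary o K d (d - 1)))).mkQ ∘ₗ (normalCycles o K A d).subtype) := by
  constructor
  · rw [injective_iff_map_eq_zero]
    rintro ⟨⟨z, hz⟩, hzA⟩ h0
    have h1 := (Submodule.Quotient.mk_eq_zero _).1 h0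
    obtain ⟨x, hx⟩ := h1
    change boundary o K (d + 1) d x = z at hx
    -- If `z = ∂x`, replacing `x` by `x - ∂y` does not change the boundary but moves the chain onto
    -- `B`. Its boundary `z` vanishes on `A`, so `x - ∂y` is zero and `z = ∂∂y = 0`.
    obtain ⟨y, -, hy⟩ := h.exists_reduction hfin (i := d + 1 + 1) rfl x
    have hzero : x - boundary o K (d + 1 + 1) (d + 1) y = 0 := by
      refine h.eq_zero_of_boundary hfin (j := d) rfl (fun τ hτ => ?_) fun σ hσ => ?_
      · exact hy τ ((hU τ).resolve_right hτ)
      · rw [map_sub, hdd, sub_zero, hx]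
        exact hzA σ hσ
    have : z = 0 := by
      rw [← hx, sub_eq_zero.1 hzero, hdd]
    subst this
    rfl
  · intro c
    obtain ⟨⟨z, hz⟩, rfl⟩ := Submodule.Quotient.mk_surjective _ c
    obtain ⟨y, -, hy⟩ := h.exists_reduction hfin (i := d + 1) rfl z
    refine ⟨⟨⟨z - boundary o K (d + 1) d y, ?_⟩, hy⟩, ?_⟩
    · rw [LinearMap.mem_ker, map_sub, hdd, LinearMap.mem_ker.1 hz, sub_zero]
    · refine (Submodule.Quotient.eq _).2 ⟨-y, ?_⟩
      rw [map_neg]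
      change _ = z - boundary o K (d + 1) d y - z
      abel

/-- Restriction of a cycle that vanishes on `A` to the unmatched cells. -/
def restrictUnmatched (o : Orientations E) (K A B : Set (Set E)) (d : ℤ) :
    normalCycles o K A d →ₗ[ℤ] ({σ : Cell K d // σ.1 ∉ A ∪ B} → ℤ) where
  toFun z σ := z.1.1 σ.1
  map_add' _ _ := rfl
  map_smul' _ _ := rfl

/-- A cycle that vanishes both on `A` and on the unmatched cells lives on `B`, so it is zero.
Conversely, values `v` on the unmatched cells are corrected to a cycle by subtracting a chain `y` on
`B`, which alters no value on `A` or on the unmatched cells. -/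
theorem bijective_restrictUnmatched (h : IsAcyclicMatching o K A B μ r)
    (hfin : ∀ i, Finite (Cell K i))
    (hdd : ∀ {i j l : ℤ} (x : Chain K i), boundary o K j l (boundary o K i j x) = 0)
    {d : ℤ} (hU : ∀ σ : Cell K (d - 1), σ.1 ∈ A ∪ B) :
    Function.Bijective (restrictUnmatched o K A B d) := by
  constructor
  · rw [injective_iff_map_eq_zero]
    rintro ⟨⟨z, hz⟩, hzA⟩ h0
    have : z = 0 := by
      refine h.eq_zero_of_boundary hfin (j := d - 1) (by omega) (fun τ hτ => ?_) fun σ _ => ?_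
      · by_cases hA : τ.1 ∈ A
        · exact hzA τ hA
        · exact congrFun h0 ⟨τ, fun h => h.elim hA hτ⟩
      · rw [LinearMap.mem_ker.1 hz]; rfl
    subst this
    rfl
  · intro u
    classical
    have := hfin d
    let v : Chain K d := Finsupp.equivFunOnFinite.symm
      fun σ => if hσ : σ.1 ∉ A ∪ B then u ⟨σ, hσ⟩ else 0
    have hv : ∀ σ, v σ = if hσ : σ.1 ∉ A ∪ B then u ⟨σ, hσ⟩ else 0 := fun σ => rfl
    obtain ⟨y, hyB, hy⟩ := h.exists_reduction hfin (i := d) (j := d - 1) (by omega)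
      (boundary o K d (d - 1) v)
    have hcycle : boundary o K d (d - 1) (v - y) = 0 := by
      -- The boundary of `v - y` vanishes on `A` by the choice of `y`. All cells of degree `d - 1`
      -- are matched, so it lives on `B`; it is also a cycle, hence zero.
      refine h.eq_zero_of_boundary hfin (j := d - 1 - 1) (by omega) (fun τ hτ => ?_) fun σ _ => ?_
      · rw [map_sub]
        exact hy τ ((hU τ).resolve_right hτ)
      · rw [hdd]; rfl
    refine ⟨⟨⟨v - y, hcycle⟩, fun σ hσ => ?_⟩, ?_⟩
    · change v σ - y σ = 0
      rw [hv, dif_neg (fun h' => h' (Or.inl hσ)), hyB σ (h.disjoint.notMem_of_mem_left hσ), sub_zero]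
    · ext σ
      change v σ.1 - y σ.1 = u σ
      rw [hv, dif_pos σ.2, hyB σ.1 (fun h' => σ.2 (Or.inr h')), sub_zero]

theorem nonempty_linearEquiv (h : IsAcyclicMatching o K A B μ r)
    (hfin : ∀ i, Finite (Cell K i))
    (hdd : ∀ {i j l : ℤ} (x : Chain K i), boundary o K j l (boundary o K i j x) = 0)
    {d : ℤ} (hU : ∀ F ∈ insert ∅ K, F ∉ A ∪ B → dim F = d) :
    Nonempty (ReducedHomology o K d ≃ₗ[ℤ] ({σ : Cell K d // σ.1 ∉ A ∪ B} → ℤ)) := by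
  have hU' : ∀ i ≠ d, ∀ σ : Cell K i, σ.1 ∈ A ∪ B := fun i hi σ => by
    by_contra hn
    exact hi (σ.2.2.symm.trans (hU _ σ.2.1 hn))
  exact ⟨(LinearEquiv.ofBijective _ (h.bijective_normalCycles_mkQ hfin hdd
    (hU' _ (by omega)))).symm.trans (LinearEquiv.ofBijective _
    (h.bijective_restrictUnmatched hfin hdd (hU' _ (by omega))))⟩

/-- A complex whose unmatched cells all have dimension `d` has the homology of a wedge of
`d`-spheres, one for each unmatched cell. -/
theorem homologyConcentratedIn (h : IsAcyclicMatching o K A B μ r)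
    (hfin : ∀ i, Finite (Cell K i))
    (hdd : ∀ {i j l : ℤ} (x : Chain K i), boundary o K j l (boundary o K i j x) = 0)
    {d : ℤ} {U : Set (Set E)} (hU : ∀ F, F ∈ U ↔ F ∈ insert ∅ K ∧ F ∉ A ∪ B)
    (hne : U.Nonempty) (hd : ∀ F ∈ U, dim F = d) :
    HomologyConcentratedIn o K d ∧
      Nonempty (ReducedHomology o K d ≃+ (Fin U.ncard → ℤ)) := by
  have hUd : ∀ F ∈ insert ∅ K, F ∉ A ∪ B → dim F = d := fun F hF hn => hd F ((hU F).2 ⟨hF, hn⟩)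
  obtain ⟨e⟩ := h.nonempty_linearEquiv hfin hdd hUd
  let φ : {σ : Cell K d // σ.1 ∉ A ∪ B} ≃ U :=
    { toFun := fun σ => ⟨σ.1.1, (hU _).2 ⟨σ.1.2.1, σ.2⟩⟩
      invFun := fun F => ⟨⟨F.1, ((hU _).1 F.2).1, hd _ F.2⟩, ((hU _).1 F.2).2⟩
      left_inv := fun _ => rfl
      right_inv := fun _ => rfl }
  have := hfin d
  have : Finite U := Finite.of_equiv _ φ
  have : Nonempty U := hne.to_subtype
  refine ⟨⟨?_, fun i hi => ?_⟩, ?_⟩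
  · have : Nonempty {σ : Cell K d // σ.1 ∉ A ∪ B} := φ.nonempty
    exact e.toEquiv.nontrivial
  · refine h.subsingleton_reducedHomology hfin hdd fun σ => ?_
    by_contra hn
    exact hi (σ.2.2.symm.trans (hUd _ σ.2.1 hn))
  · have ψ : U ≃ Fin U.ncard := (Finite.equivFin U).trans (finCongr (Nat.card_coe_set_eq U))
    exact ⟨e.toAddEquiv.trans
      (LinearEquiv.funCongrLeft ℤ ℤ (φ.trans ψ).symm).toAddEquiv⟩

end IsAcyclicMatching

end Matching

end FaceComplex

namespace Hypersimplex

open FaceComplex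

variable {n k : ℕ}

/-! ### Words -/

/-- The positions of the letter `*`. -/
def stars (S : Word n) : Set (Fin n) := {i | S i = .star}

/-- `S` arises from `T` by replacing some of the `*`s with `0`s and `1`s. -/
def Refines (S T : Word n) : Prop := ∀ i, T i ≠ .star → S i = T i

open Classical in
/-- Replaces the letters of `R` at the positions in `A` with `*`. -/
noncomputable def addStars (R : Word n) (A : Set (Fin n)) : Word n :=
  fun i => if i ∈ A then .star else R i

theorem count_add_count_add_count (S : Word n) :
    count S .one + count S .zero + count S .star = n := by
  have h1 : Disjoint {i | S i = .one} {i | S i = .zero} := by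
    rw [Set.disjoint_left]
    intro i h h'
    simp_all
  have h2 : Disjoint ({i | S i = .one} ∪ {i | S i = .zero}) {i | S i = .star} := by
    rw [Set.disjoint_left]
    rintro i (h | h) h' <;> simp_all
  rw [count, count, count, ← ncard_union_eq h1, ← ncard_union_eq h2]
  have : {i | S i = .one} ∪ {i | S i = .zero} ∪ {i | S i = .star} = univ := by
    ext i
    cases h : S i <;> simp [h]
  rw [this, ncard_univ, Nat.card_eq_fintype_card, Fintype.card_fin]

theorem count_pos {S : Word n} {a : Letter} {i : Fin n} (h : S i = a) : 0 < count S a :=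
  (ncard_pos).2 ⟨i, h⟩

theorem exists_of_count_pos {S : Word n} {a : Letter} (h : 0 < count S a) : ∃ i, S i = a :=
  (ncard_pos).1 h

theorem IsFaceWord.lt_of_star {S : Word n} (hS : IsFaceWord k S) {i : Fin n} (hi : S i = .star) :
    count S .one < k ∧ count S .zero + k < n := by
  rcases hS with ⟨h1, h2⟩ | h
  · have := count_add_count_add_count S
    have := count_pos hi
    omega
  · exact h

/-- At most `k - 1` ones and `n - k - 1` zeros leave room for at least two `*`s. -/
theorem IsFaceWord.exists_ne_star {S : Word n} (hS : IsFaceWord k S) {i : Fin n}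
    (hi : S i = .star) : ∃ j, S j = .star ∧ j ≠ i := by
  obtain ⟨h1, h2⟩ := hS.lt_of_star hi
  have := count_add_count_add_count S
  have h3 : 1 < (stars S).ncard := by
    change 1 < count S .star
    omega
  exact Set.exists_ne_of_one_lt_ncard h3 i

theorem Refines.antisymm {S T : Word n} (h : Refines S T) (h' : Refines T S) : S = T := by
  ext i
  by_cases hT : T i = .star
  · by_cases hS : S i = .star
    · rw [hS, hT]
    · exact (h' i hS).symm
  · exact h i hT

theorem Refines.stars_subset {S T : Word n} (h : Refines S T) : stars S ⊆ stars T := by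
  intro i hi
  by_contra hT
  exact hT ((h i hT).symm.trans hi)

theorem Refines.eq_of_stars_eq {R S S' : Word n} (h : Refines R S) (h' : Refines R S')
    (hst : stars S = stars S') : S = S' := by
  ext i
  by_cases hi : S i = .star
  · have : i ∈ stars S' := hst ▸ hi
    rw [hi, this]
  · have : i ∉ stars S' := hst ▸ hi
    rw [← h i hi, ← h' i this]

theorem refines_addStars (R : Word n) (A : Set (Fin n)) : Refines R (addStars R A) := by
  intro i hi
  by_cases h : i ∈ A
  · simp [addStars, h] at hi
  · simp [addStars, h]

theorem stars_addStars {R : Word n} {A : Set (Fin n)} (h : stars R ⊆ A) :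
    stars (addStars R A) = A := by
  ext i
  by_cases hi : i ∈ A
  · simp [stars, addStars, hi]
  · simpa [stars, addStars, hi] using fun h' => hi (h h')

theorem Refines.addStars_refines {R T : Word n} {A : Set (Fin n)} (h : Refines R T)
    (hA : A ⊆ stars T) : Refines (addStars R A) T := by
  intro i hi
  have : i ∉ A := fun h' => hi (hA h')
  simpa [addStars, this] using h i hi

theorem Refines.count_le {S T : Word n} (h : Refines S T) {a : Letter} (ha : a ≠ .star) :
    count T a ≤ count S a := by
  refine ncard_le_ncard fun i (hi : T i = a) => ?_
  exact (h i (by rw [hi]; exact ha)).trans hi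

theorem Refines.count_lt {S T : Word n} (h : Refines S T) {a : Letter} (ha : a ≠ .star)
    {i : Fin n} (hS : S i = a) (hT : T i ≠ a) : count T a < count S a := by
  refine ncard_lt_ncard ⟨fun i (hi : T i = a) => ?_, fun h' => hT (h' hS)⟩
  exact (h i (by rw [hi]; exact ha)).trans hi

/-! ### Vertices -/

/-- The vertices of `F(S)`. -/
def verts (k : ℕ) (S : Word n) : Set (Fin n → ℝ) :=
  {x ∈ points n k | ∀ i, (S i = .zero → x i = 0) ∧ (S i = .one → x i = 1)}

theorem face_eq (S : Word n) : face k S = convexHull ℝ (verts k S) := rfl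

open Classical in
/-- The point with coordinates `1` in `A` and `0` elsewhere. -/
noncomputable def point (A : Set (Fin n)) : Fin n → ℝ := fun i => if i ∈ A then 1 else 0

theorem sum_point (A : Set (Fin n)) : ∑ i, point A i = A.ncard := by
  classical
  simp [point, ncard_eq_toFinset_card']

theorem point_mem_points {A : Set (Fin n)} (h : A.ncard = k) : point A ∈ points n k := by
  refine ⟨fun i => ?_, by rw [sum_point, h]⟩
  by_cases hi : i ∈ A <;> simp [point, hi]

theorem eq_point {x : Fin n → ℝ} (hx : x ∈ points n k) : x = point {i | x i = 1} := by
  ext i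
  rcases hx.1 i with h | h <;> simp [point, h]

theorem ncard_ones {x : Fin n → ℝ} (hx : x ∈ points n k) : {i | x i = 1}.ncard = k := by
  have h := hx.2
  rw [eq_point hx, sum_point] at h
  exact_mod_cast h

/-- The ones of the vertex form a `k`-set that contains `i` and all ones of `S` and avoids `j` and
all zeros of `S`. The two strict inequalities for the counts are exactly what makes room for it. -/
theorem IsFaceWord.exists_vertex {S : Word n} (hS : IsFaceWord k S) {i j : Fin n}
    (hi : S i = .star) (hj : S j = .star) (hij : i ≠ j) : ∃ x ∈ verts k S, x i = 1 ∧ x j = 0 := by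
  obtain ⟨h1, h2⟩ := hS.lt_of_star hi
  obtain ⟨A, hA1, hA2, hA⟩ := Set.exists_subsuperset_card_eq (s := insert i {l | S l = .one})
    (t := {l | S l ≠ .zero} \ {j}) (n := k) (by
      rintro l (rfl | hl)
      · exact ⟨by simp [hi], hij⟩
      · have hl' : S l = .one := hl
        exact ⟨by simp [hl'], by rintro rfl; simp [hj] at hl'⟩)
    ((ncard_insert_le _ _).trans h1) (by
      have h3 : {l | S l ≠ .zero}.ncard + count S .zero = n := by
        have := ncard_add_ncard_compl {l | S l = .zero}
        rw [Nat.card_eq_fintype_card, Fintype.card_fin] at this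
        rw [add_comm]
        exact this
      have h4 : j ∈ {l | S l ≠ .zero} := by simp [hj]
      rw [ncard_sdiff_singleton_of_mem h4]
      omega)
  refine ⟨point A, ⟨point_mem_points hA, fun l => ⟨fun hl => ?_, fun hl => ?_⟩⟩, ?_, ?_⟩
  · exact if_neg fun h => (hA2 h).1 hl
  · exact if_pos (hA1 (Or.inr hl))
  · exact if_pos (hA1 (Or.inl rfl))
  · exact if_neg fun h => (hA2 h).2 rfl

/-- The word without `*`s that denotes a vertex. -/
noncomputable def wordOf (x : Fin n → ℝ) : Word n :=
  open Classical in fun i => if x i = 1 then .one else .zero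

theorem stars_wordOf (x : Fin n → ℝ) : stars (wordOf x) = ∅ := by
  ext i
  by_cases h : x i = 1 <;> simp [stars, wordOf, h]

theorem count_one_wordOf {x : Fin n → ℝ} (hx : x ∈ points n k) : count (wordOf x) .one = k := by
  rw [← ncard_ones hx, count]
  congr 1
  ext i
  by_cases h : x i = 1 <;> simp [wordOf, h]

theorem isFaceWord_of_stars_eq_empty {S : Word n} (h : stars S = ∅) (h1 : count S .one = k) :
    IsFaceWord k S := by
  refine Or.inl ⟨h1, ?_⟩
  have h2 := count_add_count_add_count S
  have h3 : count S .star = 0 := by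
    change (stars S).ncard = 0
    rw [h, ncard_empty]
  omega

theorem isFaceWord_wordOf {x : Fin n → ℝ} (hx : x ∈ points n k) : IsFaceWord k (wordOf x) :=
  isFaceWord_of_stars_eq_empty (stars_wordOf x) (count_one_wordOf hx)

theorem verts_wordOf {x : Fin n → ℝ} (hx : x ∈ points n k) : verts k (wordOf x) = {x} := by
  ext y
  constructor
  · rintro ⟨-, hy⟩
    ext i
    rcases hx.1 i with h | h
    · rw [h]; exact (hy i).1 (by simp [wordOf, h])
    · rw [h]; exact (hy i).2 (by simp [wordOf, h])
  · rintro rfl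
    refine ⟨hx, fun i => ?_⟩
    rcases hx.1 i with h | h <;> simp [wordOf, h]

theorem face_wordOf {x : Fin n → ℝ} (hx : x ∈ points n k) : face k (wordOf x) = {x} := by
  rw [face_eq, verts_wordOf hx, convexHull_singleton]

theorem IsFaceWord.exists_eq_wordOf {S : Word n} (hS : IsFaceWord k S) (h : stars S = ∅) :
    ∃ x ∈ points n k, S = wordOf x := by
  have hns : ∀ i, S i ≠ .star := fun i hi => by
    have : i ∈ stars S := hi
    rw [h] at this
    exact this
  have h1 : count S .one = k := by
    rcases hS with h1 | ⟨h1, h2⟩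
    · exact h1.1
    · have h2 := count_add_count_add_count S
      have h3 : count S .star = 0 := by
        change (stars S).ncard = 0
        rw [h, ncard_empty]
      omega
  refine ⟨point {i | S i = .one}, point_mem_points h1, ?_⟩
  ext i
  cases hi : S i with
  | zero => simp [wordOf, point, hi]
  | one => simp [wordOf, point, hi]
  | star => exact absurd hi (hns i)

theorem IsFaceWord.exists_vertex_one {S : Word n} (hS : IsFaceWord k S) {i : Fin n}
    (hi : S i ≠ .zero) : ∃ x ∈ verts k S, x i = 1 := by
  by_cases h : ∃ j, S j = .star
  · obtain ⟨j, hj⟩ := h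
    obtain ⟨l, hl, hlj⟩ := hS.exists_ne_star hj
    obtain ⟨x, hx, hx1, hx2⟩ := hS.exists_vertex hj hl hlj.symm
    cases hi' : S i with
    | zero => exact absurd hi' hi
    | one => exact ⟨x, hx, (hx.2 i).2 hi'⟩
    | star =>
      obtain ⟨l, hl, hli⟩ := hS.exists_ne_star hi'
      obtain ⟨x, hx, hx1, hx2⟩ := hS.exists_vertex hi' hl hli.symm
      exact ⟨x, hx, hx1⟩
  · obtain ⟨x, hx, rfl⟩ := hS.exists_eq_wordOf (eq_empty_of_forall_notMem fun j hj => h ⟨j, hj⟩)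
    refine ⟨x, by rw [verts_wordOf hx]; rfl, ?_⟩
    by_contra h1
    exact hi (if_neg h1)

theorem IsFaceWord.exists_vertex_zero {S : Word n} (hS : IsFaceWord k S) {i : Fin n}
    (hi : S i ≠ .one) : ∃ x ∈ verts k S, x i = 0 := by
  by_cases h : ∃ j, S j = .star
  · obtain ⟨j, hj⟩ := h
    obtain ⟨l, hl, hlj⟩ := hS.exists_ne_star hj
    obtain ⟨x, hx, hx1, hx2⟩ := hS.exists_vertex hj hl hlj.symm
    cases hi' : S i with
    | one => exact absurd hi' hi
    | zero => exact ⟨x, hx, (hx.2 i).1 hi'⟩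
    | star =>
      obtain ⟨l, hl, hli⟩ := hS.exists_ne_star hi'
      obtain ⟨x, hx, hx1, hx2⟩ := hS.exists_vertex hl hi' hli
      exact ⟨x, hx, hx2⟩
  · obtain ⟨x, hx, rfl⟩ := hS.exists_eq_wordOf (eq_empty_of_forall_notMem fun j hj => h ⟨j, hj⟩)
    refine ⟨x, by rw [verts_wordOf hx]; rfl, ?_⟩
    rcases hx.1 i with h1 | h1
    · exact h1
    · exact absurd (if_pos h1) hi

theorem IsFaceWord.verts_nonempty {S : Word n} (hS : IsFaceWord k S) : (verts k S).Nonempty := by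
  by_cases h : ∃ j, S j = .star
  · obtain ⟨j, hj⟩ := h
    obtain ⟨x, hx, -⟩ := hS.exists_vertex_one (i := j) (by simp [hj])
    exact ⟨x, hx⟩
  · obtain ⟨x, hx, rfl⟩ := hS.exists_eq_wordOf (eq_empty_of_forall_notMem fun j hj => h ⟨j, hj⟩)
    rw [verts_wordOf hx]
    exact singleton_nonempty x

theorem IsFaceWord.face_nonempty {S : Word n} (hS : IsFaceWord k S) : (face k S).Nonempty :=
  hS.verts_nonempty.mono (subset_convexHull ℝ _)

theorem apply_eq_of_mem_face {T : Word n} {x : Fin n → ℝ} (hx : x ∈ face k T) (i : Fin n) :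
    (T i = .zero → x i = 0) ∧ (T i = .one → x i = 1) := by
  have key : ∀ c : ℝ, (∀ y ∈ verts k T, y i = c) → x i = c := fun c hc => by
    have hconv : Convex ℝ {y : Fin n → ℝ | y i = c} := by
      intro a ha b hb s t hs ht hst
      simp only [mem_ofPred_eq] at ha hb ⊢
      simp [ha, hb, ← add_mul, hst]
    exact convexHull_min hc hconv hx
  exact ⟨fun h => key 0 fun y hy => (hy.2 i).1 h, fun h => key 1 fun y hy => (hy.2 i).2 h⟩

theorem Refines.face_subset {S T : Word n} (h : Refines S T) : face k S ⊆ face k T := by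
  refine convexHull_mono fun x hx => ⟨hx.1, fun i => ⟨fun hi => ?_, fun hi => ?_⟩⟩
  · exact (hx.2 i).1 (by rw [h i (by simp [hi]), hi])
  · exact (hx.2 i).2 (by rw [h i (by simp [hi]), hi])

/-- In a face word no letter is redundant: unless `S i` is `0`, some vertex of `F(S)` has `i`-th
coordinate `1`, and likewise with `0` and `1` exchanged. So the vertices detect every letter of `T`
that is not `*`. -/
theorem face_subset_iff {S T : Word n} (hS : IsFaceWord k S) :
    face k S ⊆ face k T ↔ Refines S T := by
  refine ⟨fun h i hi => ?_, Refines.face_subset⟩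
  cases hT : T i with
  | star => exact absurd hT hi
  | zero =>
    by_contra h0
    obtain ⟨x, hx, hx1⟩ := hS.exists_vertex_one h0
    have := (apply_eq_of_mem_face (h (subset_convexHull ℝ _ hx)) i).1 hT
    rw [hx1] at this
    exact one_ne_zero this
  | one =>
    by_contra h0
    obtain ⟨x, hx, hx1⟩ := hS.exists_vertex_zero h0
    have := (apply_eq_of_mem_face (h (subset_convexHull ℝ _ hx)) i).2 hT
    rw [hx1] at this
    exact zero_ne_one this

theorem face_injective {S T : Word n} (hS : IsFaceWord k S) (hT : IsFaceWord k T)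
    (h : face k S = face k T) : S = T :=
  ((face_subset_iff hS).1 h.subset).antisymm ((face_subset_iff hT).1 h.superset)

theorem face_ssubset_iff {S T : Word n} (hS : IsFaceWord k S) (hT : IsFaceWord k T) :
    face k S ⊂ face k T ↔ Refines S T ∧ S ≠ T := by
  rw [ssubset_iff_subset_ne, face_subset_iff hS]
  exact and_congr_right fun _ => not_congr ⟨face_injective hS hT, fun h => h ▸ rfl⟩

/-! ### Dimensions -/

theorem vectorSpan_convexHull {E : Type*} [AddCommGroup E] [Module ℝ E] (s : Set E) :
    vectorSpan ℝ (convexHull ℝ s) = vectorSpan ℝ s := by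
  rw [← direction_affineSpan, affineSpan_convexHull, direction_affineSpan]

theorem comp_swap_mem_verts {S : Word n} {x : Fin n → ℝ} (hx : x ∈ verts k S) {i j : Fin n}
    (hi : S i = .star) (hj : S j = .star) : x ∘ Equiv.swap i j ∈ verts k S := by
  refine ⟨⟨fun l => hx.1.1 _, ?_⟩, fun l => ?_⟩
  · rw [← hx.1.2]
    exact Equiv.sum_comp (Equiv.swap i j) x
  · by_cases hli : l = i
    · subst hli; simp [hi]
    by_cases hlj : l = j
    · subst hlj; simp [hj]
    simpa [Equiv.swap_apply_of_ne_of_ne hli hlj] using hx.2 l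

/-- Both sides are spanned by the differences `e_i - e_j` over positions `i`, `j` of `*`s. The right
side is the direction of an affinely independent family, so its dimension can be counted. -/
theorem vectorSpan_face {S : Word n} (hS : IsFaceWord k S) {i₀ : Fin n} (h₀ : S i₀ = .star) :
    vectorSpan ℝ (face k S) =
      vectorSpan ℝ (range fun i : stars S => (Pi.single i.1 1 : Fin n → ℝ)) := by
  rw [face_eq, vectorSpan_convexHull]
  apply le_antisymm
  · conv_lhs => rw [vectorSpan_def]
    rw [Submodule.span_le]
    rintro _ ⟨x, hx, y, hy, rfl⟩
    have hsum : ∑ i, (x i - y i) = 0 := by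
      rw [Finset.sum_sub_distrib, hx.1.2, hy.1.2, sub_self]
    have heq : x - y = ∑ i, (x i - y i) • ((Pi.single i 1 : Fin n → ℝ) - Pi.single i₀ 1) := by
      simp_rw [smul_sub]
      rw [Finset.sum_sub_distrib, ← Finset.sum_smul, hsum, zero_smul, sub_zero]
      ext j
      simp [Finset.sum_apply, Pi.single_apply]
    change x - y ∈ _
    rw [heq]
    refine Submodule.sum_mem _ fun i _ => ?_
    cases hi : S i with
    | zero => simp [(hx.2 i).1 hi, (hy.2 i).1 hi]
    | one => simp [(hx.2 i).2 hi, (hy.2 i).2 hi]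
    | star =>
      exact Submodule.smul_mem _ _ (vsub_mem_vectorSpan ℝ (mem_range_self (⟨i, hi⟩ : stars S))
        (mem_range_self (⟨i₀, h₀⟩ : stars S)))
  · conv_lhs => rw [vectorSpan_def]
    rw [Submodule.span_le]
    rintro _ ⟨_, ⟨⟨i, hi⟩, rfl⟩, _, ⟨⟨j, hj⟩, rfl⟩, rfl⟩
    change (Pi.single i 1 : Fin n → ℝ) - Pi.single j 1 ∈ _
    by_cases hij : i = j
    · subst hij; simp
    obtain ⟨x, hx, hxi, hxj⟩ := hS.exists_vertex hi hj hij
    -- The vertex `x` has `1` at `i` and `0` at `j`; exchanging these coordinates gives another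
    -- vertex of the face, and the two differ by `e_i - e_j`.
    have heq : (Pi.single i 1 : Fin n → ℝ) - Pi.single j 1 = x - x ∘ Equiv.swap i j := by
      ext l
      by_cases hli : l = i
      · subst hli
        simp [hxi, hxj, hij]
      by_cases hlj : l = j
      · subst hlj
        simp [hxi, hxj, hli]
      simp [Equiv.swap_apply_of_ne_of_ne hli hlj, hli, hlj]
    rw [heq]
    exact vsub_mem_vectorSpan ℝ hx (comp_swap_mem_verts hx hi hj)

/-- Truncated subtraction makes the formula uniform: a vertex has no `*` and `0 - 1 = 0`. All later
dimension equations are stated in this form. -/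
theorem finrank_face {S : Word n} (hS : IsFaceWord k S) :
    finrank ℝ (vectorSpan ℝ (face k S)) = (stars S).ncard - 1 := by
  by_cases h : ∃ i, S i = .star
  · obtain ⟨i₀, h₀⟩ := h
    have hli : LinearIndependent ℝ fun i : stars S => (Pi.single i.1 1 : Fin n → ℝ) := by
      have := (Pi.basisFun ℝ (Fin n)).linearIndependent.comp (fun i : stars S => i.1)
        Subtype.val_injective
      convert this using 2
      simp
    have hpos : 0 < (stars S).ncard := (ncard_pos).2 ⟨i₀, h₀⟩
    have := Fintype.ofFinite (stars S)
    rw [vectorSpan_face hS h₀]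
    refine hli.affineIndependent.finrank_vectorSpan ?_
    rw [← Nat.card_eq_fintype_card, Nat.card_coe_set_eq]
    omega
  · have h' : stars S = ∅ := eq_empty_of_forall_notMem fun j hj => h ⟨j, hj⟩
    obtain ⟨x, hx, rfl⟩ := hS.exists_eq_wordOf h'
    rw [face_wordOf hx, h', ncard_empty, vectorSpan_singleton]
    simp

/-! ### Words and faces -/

/-- By Krein–Milman a face is the closed convex hull of its extreme points. These are extreme points
of `J n k`, hence among the finitely many `points n k`, so the closure can be dropped. -/
theorem IsFace.eq_convexHull {F : Set (Fin n → ℝ)} (hF : IsFace (J n k) F) :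
    F = convexHull ℝ (F ∩ points n k) := by
  have hc : IsCompact (J n k) := (finite_points n k).isCompact_convexHull (𝕜 := ℝ)
  have hconv : Convex ℝ F := hF.2.convex (convex_convexHull ℝ _)
  have h1 : closure (convexHull ℝ (F.extremePoints ℝ)) = F :=
    closure_convexHull_extremePoints (hF.2.isCompact hc) hconv
  have h2 : F.extremePoints ℝ ⊆ points n k :=
    (hF.2.isExtreme.extremePoints_subset_extremePoints).trans
      (extremePoints_convexHull_subset (𝕜 := ℝ))
  have h3 : IsClosed (convexHull ℝ (F.extremePoints ℝ)) :=
    (((finite_points n k).subset h2).isCompact_convexHull (𝕜 := ℝ)).isClosed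
  rw [h3.closure_eq] at h1
  apply subset_antisymm
  · conv_lhs => rw [← h1]
    exact convexHull_mono (subset_inter extremePoints_subset h2)
  · exact convexHull_min inter_subset_left hconv

theorem sum_mul_le {c x : Fin n → ℝ} (hx : x ∈ points n k) :
    ∑ i, c i * x i ≤ ∑ i, max (c i) 0 := by
  refine Finset.sum_le_sum fun i _ => ?_
  rcases hx.1 i with h | h <;> simp [h]

theorem sum_mul_eq_iff {c x : Fin n → ℝ} (hx : x ∈ points n k) :
    ∑ i, c i * x i = ∑ i, max (c i) 0 ↔ ∀ i, (c i < 0 → x i = 0) ∧ (0 < c i → x i = 1) := by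
  rw [Finset.sum_eq_sum_iff_of_le fun i _ => by rcases hx.1 i with h | h <;> simp [h]]
  constructor
  · intro h i
    have hi := h i (Finset.mem_univ i)
    rcases hx.1 i with h0 | h0
    · rw [h0, mul_zero] at hi
      refine ⟨fun _ => h0, fun hc => ?_⟩
      rw [max_eq_left hc.le] at hi
      exact absurd hi hc.ne
    · rw [h0, mul_one] at hi
      refine ⟨fun hc => ?_, fun _ => h0⟩
      rw [max_eq_right hc.le] at hi
      exact absurd hi hc.ne
  · intro h i _
    rcases lt_trichotomy (c i) 0 with hc | hc | hc
    · rw [(h i).1 hc, max_eq_right hc.le, mul_zero]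
    · rw [hc, max_self, zero_mul]
    · rw [(h i).2 hc, max_eq_left hc.le, mul_one]

open Classical in
/-- The word whose face maximizes the functional with coefficients `c - t`. -/
noncomputable def thresholdWord (c : Fin n → ℝ) (t : ℝ) : Word n :=
  fun i => if c i < t then .zero else if t < c i then .one else .star

/-- The coordinate sum is constant on the points, so subtracting `t` from all coefficients changes
the functional by the constant `t * k`. The shifted functional is then maximized coordinate by
coordinate; `t` plays the role of a Lagrange multiplier. -/
theorem mem_verts_thresholdWord {c : Fin n → ℝ} {t : ℝ} {x : Fin n → ℝ} (hx : x ∈ points n k) :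
    x ∈ verts k (thresholdWord c t) ↔ ∑ i, c i * x i = ∑ i, max (c i - t) 0 + t * k := by
  rw [← sub_eq_iff_eq_add]
  have : ∑ i, c i * x i - t * k = ∑ i, (c i - t) * x i := by
    simp_rw [sub_mul]
    rw [Finset.sum_sub_distrib, ← Finset.mul_sum, hx.2]
  rw [this, sum_mul_eq_iff hx]
  refine ⟨fun h i => ⟨fun hi => (h.2 i).1 ?_, fun hi => (h.2 i).2 ?_⟩,
    fun h => ⟨hx, fun i => ⟨fun hi => (h i).1 ?_, fun hi => (h i).2 ?_⟩⟩⟩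
  · exact if_pos (sub_neg.1 hi)
  · have := sub_pos.1 hi
    simp [thresholdWord, this, this.not_gt]
  · unfold thresholdWord at hi
    split_ifs at hi with h1 h2
    exact sub_neg.2 h1
  · unfold thresholdWord at hi
    split_ifs at hi with h1 h2
    exact sub_pos.2 h2

theorem sum_mul_le_threshold (c : Fin n → ℝ) (t : ℝ) {x : Fin n → ℝ} (hx : x ∈ points n k) :
    ∑ i, c i * x i ≤ ∑ i, max (c i - t) 0 + t * k := by
  have h := sum_mul_le (c := fun i => c i - t) hx
  simp_rw [sub_mul] at h
  rw [Finset.sum_sub_distrib, ← Finset.mul_sum, hx.2] at h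
  linarith

theorem exists_sum_eq (l : StrongDual ℝ (Fin n → ℝ)) :
    ∃ c : Fin n → ℝ, ∀ x, l x = ∑ i, c i * x i := by
  refine ⟨fun i => l (Pi.single i 1), fun x => ?_⟩
  conv_lhs => rw [← Finset.univ_sum_single x]
  rw [map_sum]
  refine Finset.sum_congr rfl fun i _ => ?_
  have : (Pi.single i (x i) : Fin n → ℝ) = x i • Pi.single i 1 := by
    rw [← Pi.single_smul, smul_eq_mul, mul_one]
  rw [this, map_smul, smul_eq_mul, mul_comm]

theorem le_of_forall_points {l : StrongDual ℝ (Fin n → ℝ)} {M : ℝ}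
    (h : ∀ x ∈ points n k, l x ≤ M) : ∀ x ∈ J n k, l x ≤ M := by
  have hconv : Convex ℝ {x : Fin n → ℝ | l x ≤ M} := convex_halfSpace_le l.isLinear M
  exact fun x hx => convexHull_min h hconv hx

/-- If the maximum of a functional over the hypersimplex is attained at a point of
`verts k S`, where `S` is the word of a threshold, then its face is `F(S)`. -/
theorem maximizers_eq_face {l : StrongDual ℝ (Fin n → ℝ)} {c : Fin n → ℝ}
    (hl : ∀ x, l x = ∑ i, c i * x i) (t : ℝ) (hne : (verts k (thresholdWord c t)).Nonempty) :
    {x ∈ J n k | ∀ y ∈ J n k, l y ≤ l x} = face k (thresholdWord c t) ∧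
      IsFace (J n k) (face k (thresholdWord c t)) := by
  set F := {x ∈ J n k | ∀ y ∈ J n k, l y ≤ l x} with hF
  obtain ⟨p, hp⟩ := hne
  have hpJ : p ∈ J n k := subset_convexHull ℝ _ hp.1
  have hpM := (mem_verts_thresholdWord hp.1).1 hp
  have hmax : ∀ y ∈ J n k, l y ≤ ∑ i, max (c i - t) 0 + t * k :=
    le_of_forall_points fun x hx => by rw [hl]; exact sum_mul_le_threshold c t hx
  have hpF : p ∈ F := ⟨hpJ, fun y hy => by rw [hl p, hpM]; exact hmax y hy⟩
  have hface : IsFace (J n k) F := ⟨⟨p, hpF⟩, fun _ => ⟨l, hF⟩⟩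
  have heq : F = face k (thresholdWord c t) := by
    rw [IsFace.eq_convexHull hface, face_eq]
    congr 1
    ext x
    constructor
    · rintro ⟨hx, hxp⟩
      rw [mem_verts_thresholdWord hxp, ← hl]
      refine le_antisymm (hmax x hx.1) ?_
      rw [← hpM, ← hl]
      exact hx.2 p hpJ
    · intro hx
      refine ⟨⟨subset_convexHull ℝ _ hx.1, fun y hy => ?_⟩, hx.1⟩
      rw [hl x, (mem_verts_thresholdWord hx.1).1 hx]
      exact hmax y hy
  exact ⟨heq, heq ▸ hface⟩

theorem IsFaceWord.isFace {S : Word n} (hS : IsFaceWord k S) : IsFace (J n k) (face k S) := by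
  -- These coefficients have `S` as their threshold word at `t = 0`.
  let c : Fin n → ℝ := fun i => match S i with
    | .zero => -1
    | .one => 1
    | .star => 0
  have hcS : thresholdWord c 0 = S := by
    ext i
    cases h : S i <;> simp [thresholdWord, c, h]
  let l : StrongDual ℝ (Fin n → ℝ) := ∑ i, c i • ContinuousLinearMap.proj i
  have hl : ∀ x, l x = ∑ i, c i * x i := fun x => by simp [l]
  have := (maximizers_eq_face (k := k) hl 0 (by rw [hcS]; exact hS.verts_nonempty)).2
  rwa [hcS] at this

/-- The midpoint between the minimum of `c` on `A` and its maximum off `A` works. The final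
alternative mirrors the two kinds of face words: a tie across `A` and its complement makes both
counts strict, and otherwise the threshold word has no `*`. -/
theorem exists_threshold {c : Fin n → ℝ} {A : Set (Fin n)} (hA : A.Nonempty) (hA' : Aᶜ.Nonempty)
    (h : ∀ i ∈ A, ∀ j ∉ A, c j ≤ c i) :
    ∃ t, (∀ i ∈ A, t ≤ c i) ∧ (∀ j ∉ A, c j ≤ t) ∧
      (((∃ i ∈ A, c i = t) ∧ ∃ j ∉ A, c j = t) ∨ ∀ i, c i ≠ t) := by
  obtain ⟨a, ha, hmin⟩ := A.toFinite.exists_minimalFor c A hA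
  obtain ⟨b, hb, hmax⟩ := Aᶜ.toFinite.exists_maximalFor c Aᶜ hA'
  have h1 : ∀ i ∈ A, c a ≤ c i := fun i hi => (le_total (c a) (c i)).elim id fun h => hmin hi h
  have h2 : ∀ j ∉ A, c j ≤ c b := fun j hj => (le_total (c j) (c b)).elim id fun h => hmax hj h
  have hba := h a ha b hb
  refine ⟨(c a + c b) / 2, fun i hi => ?_, fun j hj => ?_, ?_⟩
  · linarith [h1 i hi]
  · linarith [h2 j hj]
  · rcases hba.eq_or_lt with heq | hlt
    · exact Or.inl ⟨⟨a, ha, by linarith⟩, ⟨b, hb, by linarith⟩⟩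
    · refine Or.inr fun i => ?_
      by_cases hiA : i ∈ A
      · exact (show (c a + c b) / 2 < c i by linarith [h1 i hiA]).ne'
      · exact (show c i < (c a + c b) / 2 by linarith [h2 i hiA]).ne

theorem comp_perm_mem_points {x : Fin n → ℝ} (hx : x ∈ points n k) (g : Equiv.Perm (Fin n)) :
    x ∘ g ∈ points n k :=
  ⟨fun _ => hx.1 _, (Equiv.sum_comp g x).trans hx.2⟩

/-- A face contains a vertex `p` that maximizes the exposing functional. Exchanging a `1` and a `0`
of `p` cannot increase the value, so the coefficients at the ones dominate those at the zeros, and a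
threshold between them yields the word. -/
theorem IsFace.exists_word (hk : 1 ≤ k) (hkn : k < n) {F : Set (Fin n → ℝ)}
    (hF : IsFace (J n k) F) : ∃ S : Word n, IsFaceWord k S ∧ F = face k S := by
  obtain ⟨l, hl⟩ := hF.2 hF.1
  obtain ⟨c, hc⟩ := exists_sum_eq l
  obtain ⟨p, hpF, hp⟩ : (F ∩ points n k).Nonempty := by
    rw [← convexHull_nonempty_iff (𝕜 := ℝ), ← IsFace.eq_convexHull hF]
    exact hF.1
  have hmax : ∀ y ∈ J n k, l y ≤ l p := by
    rw [hl] at hpF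
    exact hpF.2
  set A := {i | p i = 1} with hAdef
  have hAk : A.ncard = k := ncard_ones hp
  have hA : A.Nonempty := (ncard_pos).1 (by omega)
  have hAc : A.ncard + Aᶜ.ncard = n := by
    have := ncard_add_ncard_compl A
    rwa [Nat.card_eq_fintype_card, Fintype.card_fin] at this
  have hA' : Aᶜ.Nonempty := (ncard_pos).1 (by omega)
  have hp0 : ∀ j ∉ A, p j = 0 := fun j hj => (hp.1 j).resolve_right hj
  have hexch : ∀ i ∈ A, ∀ j ∉ A, c j ≤ c i := by
    intro i hi j hj
    have hij : i ≠ j := fun h => hj (h ▸ hi)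
    have hpi : p i = 1 := hi
    have hpj : p j = 0 := hp0 j hj
    have h1 := hmax _ (subset_convexHull ℝ _ (comp_perm_mem_points hp (Equiv.swap i j)))
    have h2 : p - p ∘ Equiv.swap i j = (Pi.single i 1 : Fin n → ℝ) - Pi.single j 1 := by
      ext m
      by_cases hmi : m = i
      · subst hmi
        simp [hpi, hpj, hij]
      by_cases hmj : m = j
      · subst hmj
        simp [hpi, hpj, hmi]
      simp [Equiv.swap_apply_of_ne_of_ne hmi hmj, hmi, hmj]
    have h3 : l p - l (p ∘ Equiv.swap i j) = c i - c j := by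
      rw [← map_sub, h2, map_sub, hc, hc]
      simp [Pi.single_apply]
    linarith
  obtain ⟨t, ht1, ht2, ht3⟩ := exists_threshold hA hA' hexch
  have hpv : p ∈ verts k (thresholdWord c t) := by
    refine ⟨hp, fun i => ⟨fun hi => hp0 i fun hiA => ?_, fun hi => ?_⟩⟩
    · have := ht1 i hiA
      simp only [thresholdWord, this.not_gt, if_false] at hi
      split_ifs at hi
    · by_contra hiA
      have := ht2 i hiA
      simp only [thresholdWord, this.not_gt, if_false] at hi
      split_ifs at hi
  refine ⟨thresholdWord c t, ?_, ?_⟩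
  · have h1 : {i | thresholdWord c t i = .one} ⊆ A := fun i hi => (hpv.2 i).2 hi
    have h2 : {i | thresholdWord c t i = .zero} ⊆ Aᶜ := fun i hi hiA => by
      have := (hpv.2 i).1 hi
      have h' : p i = 1 := hiA
      rw [this] at h'
      exact zero_ne_one h'
    rcases ht3 with ⟨⟨i, hi, hit⟩, ⟨j, hj, hjt⟩⟩ | hne
    · right
      have e1 : count (thresholdWord c t) .one < A.ncard :=
        ncard_lt_ncard ⟨h1, fun h => by
          have : thresholdWord c t i = .one := h hi
          simp [thresholdWord, hit] at this⟩
      have e2 : count (thresholdWord c t) .zero < Aᶜ.ncard :=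
        ncard_lt_ncard ⟨h2, fun h => by
          have : thresholdWord c t j = .zero := h hj
          simp [thresholdWord, hjt] at this⟩
      omega
    · refine isFaceWord_of_stars_eq_empty (eq_empty_of_forall_notMem fun i hi => ?_) ?_
      · have hi' : thresholdWord c t i = .star := hi
        unfold thresholdWord at hi'
        split_ifs at hi' with a b
        exact hne i (le_antisymm (not_lt.1 b) (not_lt.1 a))
      · rw [← hAk]
        refine congrArg ncard (subset_antisymm h1 fun i hi => ?_)
        have := lt_of_le_of_ne (ht1 i hi) (hne i).symm
        simp [thresholdWord, this, this.not_gt]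
  · rw [← (maximizers_eq_face hc t ⟨p, hpv⟩).1]
    exact hl

variable {K : Set (Set (Fin n → ℝ))}

/-! ### The face poset is thin -/

theorem IsFaceWord.isFaceWord_addStars {R : Word n} (hR : IsFaceWord k R) {A : Set (Fin n)}
    (h : (∃ i, R i = .star) ∨ (∃ i ∈ A, R i = .one) ∧ ∃ i ∈ A, R i = .zero) :
    IsFaceWord k (addStars R A) := by
  right
  have hle := fun a ha => (refines_addStars R A).count_le (a := a) ha
  have h1 := hle .one (by simp)
  have h0 := hle .zero (by simp)
  rcases h with ⟨i, hi⟩ | ⟨⟨i, hi, hi'⟩, ⟨j, hj, hj'⟩⟩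
  · have := hR.lt_of_star hi
    omega
  · have h1' := (refines_addStars R A).count_lt (by simp) hi' (by simp [addStars, hi])
    have h0' := (refines_addStars R A).count_lt (by simp) hj' (by simp [addStars, hj])
    rcases hR with h | h <;> omega

/-- A vertex of a face of positive dimension has a `1` and a `0` among the `*`s of the face. -/
theorem IsFaceWord.exists_one_zero {S R : Word n} (hS : IsFaceWord k S) (hR : IsFaceWord k R)
    (h : Refines R S) {i : Fin n} (hi : S i = .star) (hstars : stars R = ∅) :
    (∃ i ∈ stars S, R i = .one) ∧ ∃ i ∈ stars S, R i = .zero := by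
  obtain ⟨h1, h0⟩ := hS.lt_of_star hi
  obtain ⟨x, hx, rfl⟩ := hR.exists_eq_wordOf hstars
  have hc := count_one_wordOf hx
  have hz : count (wordOf x) .zero + k = n := by
    have h2 := count_add_count_add_count (wordOf x)
    have h3 : count (wordOf x) .star = 0 := by
      change (stars (wordOf x)).ncard = 0
      rw [hstars, ncard_empty]
    omega
  constructor
  · by_contra! hn
    have : count (wordOf x) .one ≤ count S .one := ncard_le_ncard fun j hj => by
      have hj' : wordOf x j = .one := hj
      have h2 : S j ≠ .star := fun h2 => hn j h2 hj'
      exact (h j h2).symm.trans hj'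
    omega
  · by_contra! hn
    have : count (wordOf x) .zero ≤ count S .zero := ncard_le_ncard fun j hj => by
      have hj' : wordOf x j = .zero := hj
      have h2 : S j ≠ .star := fun h2 => hn j h2 hj'
      exact (h j h2).symm.trans hj'
    omega

theorem IsFaceWord.stars_ncard_ne_one {S : Word n} (hS : IsFaceWord k S) :
    (stars S).ncard ≠ 1 := by
  intro h
  obtain ⟨i, hi⟩ := ncard_eq_one.1 h
  have hi' : i ∈ stars S := by rw [hi]; rfl
  obtain ⟨j, hj, hji⟩ := hS.exists_ne_star hi'
  have hj' : j ∈ stars S := hj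
  rw [hi] at hj'
  exact hji hj'

/-- The middle elements of an interval whose middle words all have exactly one more `*` than
`A₀`. -/
theorem diamond_of_stars {R T : Word n} (hRT : Refines R T)
    {A₀ : Set (Fin n)} {b c : Fin n} (hRA : stars R ⊆ A₀) (hb : b ∉ A₀) (hc : c ∉ A₀)
    (hbc : b ≠ c) (hT : stars T = insert b (insert c A₀))
    (hrk : (insert b A₀).ncard - 1 = (stars R).ncard - 1 + 1)
    (hmid : ∀ S, IsFaceWord k S → Refines R S → Refines S T →
      (stars S).ncard - 1 = (stars R).ncard - 1 + 1 → A₀ ⊆ stars S)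
    (hword : ∀ e, e = b ∨ e = c → IsFaceWord k (addStars R (insert e A₀))) :
    ∃ S₁ S₂ : Word n, IsFaceWord k S₁ ∧ IsFaceWord k S₂ ∧
      (Refines R S₁ ∧ R ≠ S₁ ∧ Refines S₁ T ∧ S₁ ≠ T ∧
        (stars S₁).ncard - 1 = (stars R).ncard - 1 + 1) ∧
      (Refines R S₂ ∧ R ≠ S₂ ∧ Refines S₂ T ∧ S₂ ≠ T ∧
        (stars S₂).ncard - 1 = (stars R).ncard - 1 + 1) ∧ ¬ Refines S₁ S₂ ∧ ¬ Refines S₂ S₁ ∧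
      ∀ S, IsFaceWord k S → Refines R S → Refines S T →
        (stars S).ncard - 1 = (stars R).ncard - 1 + 1 → S = S₁ ∨ S = S₂ := by
  have hst : ∀ e, stars (addStars R (insert e A₀)) = insert e A₀ := fun e =>
    stars_addStars (hRA.trans (subset_insert _ _))
  have hcard : ∀ e, e = b ∨ e = c → (insert e A₀).ncard = A₀.ncard + 1 := by
    rintro e (rfl | rfl)
    · exact ncard_insert_of_notMem hb
    · exact ncard_insert_of_notMem hc
  have hcb := hcard b (Or.inl rfl)
  have hcc := hcard c (Or.inr rfl)
  have key : ∀ e, e = b ∨ e = c → Refines R (addStars R (insert e A₀)) ∧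
      R ≠ addStars R (insert e A₀) ∧ Refines (addStars R (insert e A₀)) T ∧
      addStars R (insert e A₀) ≠ T ∧
      (stars (addStars R (insert e A₀))).ncard - 1 = (stars R).ncard - 1 + 1 := by
    intro e he
    have hce := hcard e he
    refine ⟨refines_addStars _ _, fun h => ?_, hRT.addStars_refines ?_, fun h => ?_, ?_⟩
    · have h1 := hst e
      rw [← h] at h1
      rw [h1] at hrk
      omega
    · rw [hT]
      rcases he with rfl | rfl
      · exact insert_subset_insert (subset_insert _ _)
      · exact subset_insert _ _
    · have h1 := hst e
      rw [h, hT] at h1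
      have h2 : (insert b (insert c A₀)).ncard = A₀.ncard + 2 := by
        rw [ncard_insert_of_notMem, hcc]
        rintro (h | h)
        · exact hbc h
        · exact hb h
      rw [h1] at h2
      omega
    · rw [hst]
      omega
  refine ⟨addStars R (insert b A₀), addStars R (insert c A₀), hword b (Or.inl rfl),
    hword c (Or.inr rfl), key b (Or.inl rfl), key c (Or.inr rfl), fun h => ?_, fun h => ?_, ?_⟩
  · have := h.stars_subset
    rw [hst, hst] at this
    rcases this (mem_insert b _) with h | h
    · exact hbc h
    · exact hb h
  · have := h.stars_subset
    rw [hst, hst] at this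
    rcases this (mem_insert c _) with h | h
    · exact hbc h.symm
    · exact hc h
  · intro S hS hRS hST hr
    have hA := hmid S hS hRS hST hr
    have hsub := hST.stars_subset
    rw [hT] at hsub
    have hne : A₀ ≠ stars S := by
      rintro rfl
      omega
    obtain ⟨e, he, heA⟩ := exists_of_ssubset (ssubset_of_subset_of_ne hA hne)
    have he' : e = b ∨ e = c := by
      rcases hsub he with h | h | h
      · exact Or.inl h
      · exact Or.inr h
      · exact absurd h heA
    have heq : stars S = insert e A₀ := by
      refine (eq_of_subset_of_ncard_le (insert_subset he hA) ?_).symm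
      have := hcard e he'
      omega
    have : S = addStars R (insert e A₀) :=
      hRS.eq_of_stars_eq (refines_addStars _ _) (by rw [hst, heq])
    rcases he' with rfl | rfl
    · exact Or.inl this
    · exact Or.inr this

/-- If `R` has a `*`, any added `*`s give a face word, so the two middle words add one of the two
new positions. If `R` is a vertex, `F(T)` is a triangle: among the three letters of `R` at the `*`s
of `T`, one differs from the other two. An edge must free both a `1` and a `0`, hence the position
of the odd letter. -/
theorem exists_diamond {R T : Word n} (hR : IsFaceWord k R) (hT : IsFaceWord k T)
    (hRT : Refines R T) (hrk : (stars T).ncard - 1 = (stars R).ncard - 1 + 2) :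
    ∃ S₁ S₂ : Word n, IsFaceWord k S₁ ∧ IsFaceWord k S₂ ∧
      (Refines R S₁ ∧ R ≠ S₁ ∧ Refines S₁ T ∧ S₁ ≠ T ∧
        (stars S₁).ncard - 1 = (stars R).ncard - 1 + 1) ∧
      (Refines R S₂ ∧ R ≠ S₂ ∧ Refines S₂ T ∧ S₂ ≠ T ∧
        (stars S₂).ncard - 1 = (stars R).ncard - 1 + 1) ∧ ¬ Refines S₁ S₂ ∧ ¬ Refines S₂ S₁ ∧
      ∀ S, IsFaceWord k S → Refines R S → Refines S T →
        (stars S).ncard - 1 = (stars R).ncard - 1 + 1 → S = S₁ ∨ S = S₂ := by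
  by_cases hstar : ∃ i, R i = .star
  · obtain ⟨i, hi⟩ := hstar
    have hpos : 0 < (stars R).ncard := (ncard_pos).2 ⟨i, hi⟩
    have hd : (stars T \ stars R).ncard = 2 := by
      rw [ncard_sdiff hRT.stars_subset]
      omega
    obtain ⟨b, c, hbc, hbcT⟩ := ncard_eq_two.1 hd
    have hb : b ∈ stars T \ stars R := by rw [hbcT]; simp
    have hc : c ∈ stars T \ stars R := by rw [hbcT]; simp
    refine diamond_of_stars hRT (A₀ := stars R) subset_rfl hb.2 hc.2 hbc ?_ ?_
      (fun S _ hRS _ _ => hRS.stars_subset) fun e _ => hR.isFaceWord_addStars (Or.inl ⟨i, hi⟩)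
    · rw [← sdiff_union_of_subset hRT.stars_subset, hbcT, insert_union, singleton_union]
    · rw [ncard_insert_of_notMem hb.2]
      omega
  · have hR0 : stars R = ∅ := eq_empty_of_forall_notMem fun j hj => hstar ⟨j, hj⟩
    rw [hR0, ncard_empty] at hrk
    have h3 : (stars T).ncard = 3 := by omega
    obtain ⟨i, hi⟩ : (stars T).Nonempty := (ncard_pos).1 (by omega)
    obtain ⟨⟨u, hu, hu1⟩, ⟨v, hv, hv0⟩⟩ := hT.exists_one_zero hR hRT hi hR0
    have huv : u ≠ v := fun h => by rw [h, hv0] at hu1; simp at hu1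
    have hw : (stars T \ {u, v}).ncard = 1 := by
      rw [ncard_sdiff (by rintro _ (rfl | rfl) <;> assumption), ncard_pair huv, h3]
    obtain ⟨w, hw⟩ := ncard_eq_one.1 hw
    have hwT : w ∈ stars T \ {u, v} := by rw [hw]; rfl
    have hwu : w ≠ u := fun h => hwT.2 (Or.inl h)
    have hwv : w ≠ v := fun h => hwT.2 (Or.inr h)
    have hTeq : stars T = {u, v, w} := by
      rw [← sdiff_union_of_subset (show ({u, v} : Set (Fin n)) ⊆ stars T by
        rintro _ (rfl | rfl) <;> assumption), hw]
      ext x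
      simp only [mem_union, mem_singleton_iff, mem_insert_iff]
      tauto
    -- Here `a` is the position of the odd letter, so every middle word has a `*` there.
    have main : ∀ (a b c : Fin n), a ≠ b → a ≠ c → b ≠ c → stars T = {b, c, a} →
        (R a = .one ∧ R b = .zero ∧ R c = .zero ∨ R a = .zero ∧ R b = .one ∧ R c = .one) →
        _ := fun a b c hab hac hbc hTabc habc =>
      diamond_of_stars (k := k) hRT (A₀ := {a}) (b := b) (c := c) (by rw [hR0]; simp)
        (fun h => hab h.symm) (fun h => hac h.symm) hbc hTabc
        (by rw [hR0, ncard_pair hab.symm, ncard_empty])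
        (fun S hS hRS hST hr => by
          rw [hR0, ncard_empty] at hr
          obtain ⟨i, hi⟩ : (stars S).Nonempty := (ncard_pos).1 (by omega)
          obtain ⟨⟨p, hp, hp1⟩, ⟨q, hq, hq0⟩⟩ := hS.exists_one_zero hR hRS hi hR0
          have hpT := hST.stars_subset hp
          have hqT := hST.stars_subset hq
          rw [hTabc] at hpT hqT
          rw [singleton_subset_iff]
          by_contra ha
          have hpa : p = b ∨ p = c := by
            rcases hpT with h | h | h
            · exact Or.inl h
            · exact Or.inr h
            · exact absurd (show p = a from h) (fun h => ha (h ▸ hp))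
          have hqa : q = b ∨ q = c := by
            rcases hqT with h | h | h
            · exact Or.inl h
            · exact Or.inr h
            · exact absurd (show q = a from h) (fun h => ha (h ▸ hq))
          rcases habc with ⟨-, h1, h2⟩ | ⟨-, h1, h2⟩
          · rcases hpa with rfl | rfl
            · rw [h1] at hp1; simp at hp1
            · rw [h2] at hp1; simp at hp1
          · rcases hqa with rfl | rfl
            · rw [h1] at hq0; simp at hq0
            · rw [h2] at hq0; simp at hq0)
        (fun e he => hR.isFaceWord_addStars (Or.inr (by
          rcases habc with ⟨ha, hb, hc⟩ | ⟨ha, hb, hc⟩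
          · exact ⟨⟨a, by simp, ha⟩, ⟨e, by simp, by rcases he with rfl | rfl <;> assumption⟩⟩
          · exact ⟨⟨e, by simp, by rcases he with rfl | rfl <;> assumption⟩, ⟨a, by simp, ha⟩⟩)))
    cases hRw : R w with
    | star => exact absurd ⟨w, hRw⟩ hstar
    | one =>
      exact main v u w huv.symm hwv.symm hwu.symm (by rw [hTeq]; ext x; simp; tauto)
        (Or.inr ⟨hv0, hu1, hRw⟩)
    | zero =>
      exact main u v w huv hwu.symm hwv.symm (by rw [hTeq]; ext x; simp; tauto)
        (Or.inl ⟨hu1, hv0, hRw⟩)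

theorem face_mem {S T : Word n} (hK : IsSubcomplex (J n k) K) (hS : IsFaceWord k S)
    (hT : face k T ∈ K) (h : Refines S T) : face k S ∈ K :=
  hK.down_closed _ hT _ hS.isFace h.face_subset

theorem isThin (hk : 1 ≤ k) (hkn : k < n) (hK : IsSubcomplex (J n k) K) : IsThin K where
  diamond := by
    intro τ hτ ρ hρ hρτ hrk
    obtain ⟨T, hT, rfl⟩ := IsFace.exists_word hk hkn (hK.isFace _ hτ)
    obtain ⟨R, hR, rfl⟩ := IsFace.exists_word hk hkn (hK.isFace _ hρ)
    rw [face_ssubset_iff hR hT] at hρτ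
    rw [finrank_face hR, finrank_face hT] at hrk
    obtain ⟨S₁, S₂, h₁, h₂, ⟨a1, a2, a3, a4, a5⟩, ⟨b1, b2, b3, b4, b5⟩, c1, c2, hS⟩ :=
      exists_diamond hR hT hρτ.1 hrk
    refine ⟨face k S₁, face_mem hK h₁ hτ a3, face k S₂, face_mem hK h₂ hτ b3, ?_, ?_, ?_, ?_, ?_⟩
    · rw [face_ssubset_iff hR h₁, face_ssubset_iff h₁ hT, finrank_face hR, finrank_face h₁]
      exact ⟨⟨a1, a2⟩, ⟨a3, a4⟩, a5⟩
    · rw [face_ssubset_iff hR h₂, face_ssubset_iff h₂ hT, finrank_face hR, finrank_face h₂]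
      exact ⟨⟨b1, b2⟩, ⟨b3, b4⟩, b5⟩
    · rwa [face_subset_iff h₁]
    · rwa [face_subset_iff h₂]
    · intro σ hσ hρσ hστ hr
      obtain ⟨S, hSw, rfl⟩ := IsFace.exists_word hk hkn (hK.isFace _ hσ)
      rw [face_ssubset_iff hR hSw] at hρσ
      rw [face_ssubset_iff hSw hT] at hστ
      rw [finrank_face hR, finrank_face hSw] at hr
      exact (hS S hSw hρσ.1 hστ.1 hr).imp (congrArg _) (congrArg _)
  edge := by
    intro τ hτ hrk
    obtain ⟨T, hT, rfl⟩ := IsFace.exists_word hk hkn (hK.isFace _ hτ)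
    rw [finrank_face hT] at hrk
    obtain ⟨u, v, huv, hTuv⟩ := ncard_eq_two.1 (show (stars T).ncard = 2 by omega)
    have hu : T u = .star := by
      have : u ∈ stars T := by rw [hTuv]; simp
      exact this
    have hv : T v = .star := by
      have : v ∈ stars T := by rw [hTuv]; simp
      exact this
    obtain ⟨x, hx, hxu, hxv⟩ := hT.exists_vertex hu hv huv
    obtain ⟨y, hy, hyv, hyu⟩ := hT.exists_vertex hv hu huv.symm
    have hmem : ∀ z ∈ verts k T, {z} ∈ K := fun z hz => by
      rw [← face_wordOf hz.1]
      refine hK.down_closed _ hτ _ (isFaceWord_wordOf hz.1).isFace ?_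
      rw [face_wordOf hz.1, singleton_subset_iff]
      exact subset_convexHull ℝ _ hz
    have heq : ∀ z ∈ points n k, z ∈ face k T → ∀ w ∈ verts k T, z u = w u → z v = w v →
        z = w := by
      intro z hz hzT w hw h1 h2
      ext i
      cases hi : T i with
      | zero => rw [(apply_eq_of_mem_face hzT i).1 hi, (hw.2 i).1 hi]
      | one => rw [(apply_eq_of_mem_face hzT i).2 hi, (hw.2 i).2 hi]
      | star =>
        have hi' : i ∈ stars T := hi
        rw [hTuv] at hi'
        rcases hi' with rfl | h
        · exact h1
        · rw [show i = v from h]; exact h2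
    refine ⟨x, y, fun h => ?_, hmem x hx, hmem y hy, subset_convexHull ℝ _ hx,
      subset_convexHull ℝ _ hy, fun σ hσ hστ hr => ?_⟩
    · rw [h, hyu] at hxu
      exact zero_ne_one hxu
    · obtain ⟨S, hS, rfl⟩ := IsFace.exists_word hk hkn (hK.isFace _ hσ)
      rw [finrank_face hS] at hr
      have h1 := hS.stars_ncard_ne_one
      have hS0 : stars S = ∅ := (ncard_eq_zero).1 (by omega)
      rw [face_ssubset_iff hS hT] at hστ
      obtain ⟨⟨p, hp, hp1⟩, ⟨q, hq, hq0⟩⟩ := hT.exists_one_zero hS hστ.1 hu hS0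
      obtain ⟨z, hz, rfl⟩ := hS.exists_eq_wordOf hS0
      have hzT : z ∈ face k T := by
        have := hστ.1.face_subset (k := k)
        rw [face_wordOf hz, singleton_subset_iff] at this
        exact this
      have hp1' : z p = 1 := by
        by_contra h
        simp [wordOf, h] at hp1
      have hq0' : z q = 0 := by
        rcases hz.1 q with h | h
        · exact h
        · simp [wordOf, h] at hq0
      have hpq : p ≠ q := fun h => by
        rw [h, hq0'] at hp1'
        exact zero_ne_one hp1'
      rw [hTuv] at hp hq
      rw [face_wordOf hz, singleton_eq_singleton_iff, singleton_eq_singleton_iff]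
      rcases hp with rfl | hp
      · obtain rfl : q = v := hq.resolve_left hpq.symm
        exact Or.inl (heq z hz hzT x hx (by rw [hp1', hxu]) (by rw [hq0', hxv]))
      · obtain rfl : p = v := hp
        obtain rfl : q = u := hq.resolve_right hpq.symm
        exact Or.inr (heq z hz hzT y hy (by rw [hq0', hyu]) (by rw [hp1', hyv]))

variable {m₀ m₁ : ℕ}

/-! ### The rules toggle the first letter other than `1` or the last letter other than `0` -/

/-- The position of the first letter other than `1`. -/
def IsFirst (S : Word n) (q : Fin n) : Prop := IsLeast {i | S i ≠ .one} q

/-- The position of the last letter other than `0`. -/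
def IsLast (S : Word n) (p : Fin n) : Prop := IsGreatest {i | S i ≠ .zero} p

theorem exists_isFirst {S : Word n} {i : Fin n} (h : S i ≠ .one) : ∃ q, IsFirst S q := by
  have hne : {i | S i ≠ .one}.Nonempty := ⟨i, h⟩
  obtain ⟨q, hq⟩ := (toFinite {i | S i ≠ .one}).exists_minimal hne
  exact ⟨q, hq.1, fun j hj => (le_total q j).elim id fun h => hq.2 hj h⟩

theorem exists_isLast {S : Word n} {i : Fin n} (h : S i ≠ .zero) : ∃ p, IsLast S p := by
  have hne : {i | S i ≠ .zero}.Nonempty := ⟨i, h⟩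
  obtain ⟨q, hq⟩ := (toFinite {i | S i ≠ .zero}).exists_maximal hne
  exact ⟨q, hq.1, fun j hj => (le_total j q).elim id fun h => hq.2 hj h⟩

theorem IsFirst.eq_one {S : Word n} {q i : Fin n} (h : IsFirst S q) (hi : i < q) : S i = .one := by
  by_contra hn
  exact (h.2 hn).not_gt hi

theorem IsLast.eq_zero {S : Word n} {p i : Fin n} (h : IsLast S p) (hi : p < i) :
    S i = .zero := by
  by_contra hn
  exact (h.2 hn).not_gt hi

theorem IsFirst.congr {S S' : Word n} {q : Fin n} (h : IsFirst S q) (hq : S' q ≠ .one)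
    (heq : ∀ i < q, S' i = S i) : IsFirst S' q := by
  refine ⟨hq, fun i hi => ?_⟩
  by_contra hn
  rw [not_le] at hn
  exact hi ((heq i hn).trans (h.eq_one hn))

theorem IsLast.congr {S S' : Word n} {p : Fin n} (h : IsLast S p) (hp : S' p ≠ .zero)
    (heq : ∀ i, p < i → S' i = S i) : IsLast S' p := by
  refine ⟨hp, fun i hi => ?_⟩
  by_contra hn
  rw [not_le] at hn
  exact hi ((heq i hn).trans (h.eq_zero hn))

/-- No `1` or `*` lies to the right of `p`, so the letter at `p` alone decides. With the mirror
statement `IsFirst.zeroLeft_iff`, the conditions in the rules become conditions on the two end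
letters. -/
theorem IsLast.oneRight_iff {S : Word n} {p : Fin n} (h : IsLast S p) :
    OneRight S ↔ S p = .one := by
  constructor
  · rintro ⟨i, hi, hi'⟩
    have hip : i ≤ p := h.2 (show S i ≠ .zero by simp [hi])
    cases hp : S p with
    | zero => exact absurd hp h.1
    | one => rfl
    | star => exact absurd (hi' p hp) hip.not_gt
  · intro hp
    refine ⟨p, hp, fun j hj => lt_of_le_of_ne (h.2 (show S j ≠ .zero by simp [hj])) ?_⟩
    rintro rfl
    rw [hp] at hj
    cases hj

theorem IsFirst.zeroLeft_iff {S : Word n} {q : Fin n} (h : IsFirst S q) :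
    ZeroLeft S ↔ S q = .zero := by
  constructor
  · rintro ⟨i, hi, hi'⟩
    have hip : q ≤ i := h.2 (show S i ≠ .one by simp [hi])
    cases hp : S q with
    | one => exact absurd hp h.1
    | zero => rfl
    | star => exact absurd (hi' q hp) hip.not_gt
  · intro hp
    refine ⟨q, hp, fun j hj => lt_of_le_of_ne (h.2 (show S j ≠ .one by simp [hj])) ?_⟩
    rintro rfl
    rw [hp] at hj
    cases hj

theorem isLast_of_oneRight {S : Word n} {p : Fin n} (hr : OneRight S)
    (h : IsGreatest {i | S i = .one} p) : IsLast S p := by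
  have h1 : S p = .one := h.1
  obtain ⟨p', hp'⟩ := exists_isLast (show S p ≠ .zero by simp [h1])
  rwa [h.unique ⟨hp'.oneRight_iff.1 hr, fun j (hj : S j = .one) =>
    hp'.2 (show S j ≠ .zero by simp [hj])⟩]

theorem isLast_of_not_oneRight {S : Word n} {p : Fin n} (hr : ¬ OneRight S)
    (h : IsGreatest {i | S i = .star} p) : IsLast S p := by
  have h1 : S p = .star := h.1
  obtain ⟨p', hp'⟩ := exists_isLast (show S p ≠ .zero by simp [h1])
  have h2 : S p' = .star := by
    cases h3 : S p' with
    | zero => exact absurd h3 hp'.1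
    | one => exact absurd (hp'.oneRight_iff.2 h3) hr
    | star => rfl
  rwa [h.unique ⟨h2, fun j (hj : S j = .star) => hp'.2 (show S j ≠ .zero by simp [hj])⟩]

theorem isFirst_of_zeroLeft {S : Word n} {q : Fin n} (hl : ZeroLeft S)
    (h : IsLeast {i | S i = .zero} q) : IsFirst S q := by
  have h1 : S q = .zero := h.1
  obtain ⟨q', hq'⟩ := exists_isFirst (show S q ≠ .one by simp [h1])
  rwa [h.unique ⟨hq'.zeroLeft_iff.1 hl, fun j (hj : S j = .zero) =>
    hq'.2 (show S j ≠ .one by simp [hj])⟩]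

theorem isFirst_of_not_zeroLeft {S : Word n} {q : Fin n} (hl : ¬ ZeroLeft S)
    (h : IsLeast {i | S i = .star} q) : IsFirst S q := by
  have h1 : S q = .star := h.1
  obtain ⟨q', hq'⟩ := exists_isFirst (show S q ≠ .one by simp [h1])
  have h2 : S q' = .star := by
    cases h3 : S q' with
    | one => exact absurd h3 hq'.1
    | zero => exact absurd (hq'.zeroLeft_iff.2 h3) hl
    | star => rfl
  rwa [h.unique ⟨h2, fun j (hj : S j = .star) => hq'.2 (show S j ≠ .one by simp [hj])⟩]

theorem IsLast.replaceRightmost {S S' : Word n} {p : Fin n} {a b : Letter} (h : IsLast S p)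
    (hp : S p = a) (hS' : S' = Function.update S p b) : ReplaceRightmost a b S S' := by
  refine ⟨p, ⟨hp, fun j (hj : S j = a) => h.2 ?_⟩, hS'⟩
  have := h.1
  change S j ≠ .zero
  rwa [hj, ← hp]

theorem IsFirst.replaceLeftmost {S S' : Word n} {q : Fin n} {a b : Letter} (h : IsFirst S q)
    (hq : S q = a) (hS' : S' = Function.update S q b) : ReplaceLeftmost a b S S' := by
  refine ⟨q, ⟨hq, fun j (hj : S j = a) => h.2 ?_⟩, hS'⟩
  have := h.1
  change S j ≠ .one
  rwa [hj, ← hq]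

theorem count_update {S : Word n} {i : Fin n} {a b : Letter} (hi : S i = a) (hab : a ≠ b) :
    count (Function.update S i b) a + 1 = count S a ∧
      count (Function.update S i b) b = count S b + 1 ∧
      ∀ c, c ≠ a → c ≠ b → count (Function.update S i b) c = count S c := by
  have hb : S i ≠ b := fun h => hab (hi.symm.trans h)
  refine ⟨?_, ?_, fun c hca hcb => ?_⟩
  · have h1 : {j | Function.update S i b j = a} = {j | S j = a} \ {i} := by
      ext j
      by_cases hj : j = i
      · subst hj; simp [hab.symm]
      · simp [hj]
    rw [count, h1]
    exact ncard_sdiff_singleton_add_one hi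
  · have h1 : {j | Function.update S i b j = b} = insert i {j | S j = b} := by
      ext j
      by_cases hj : j = i
      · subst hj; simp
      · simp [hj]
    rw [count, h1]
    exact ncard_insert_of_notMem hb
  · rw [count, count]
    congr 1
    ext j
    by_cases hj : j = i
    · subst hj; simp [hi, hca.symm, hcb.symm]
    · simp [hj]

/-- `S'` arises from `S` by replacing the last letter other than `0`, a `1`, or the first letter
other than `1`, a `0`, or both if `S` is a vertex, with `*`. -/
inductive Up (S S' : Word n) : Prop
  | last (q p : Fin n) (hqp : q < p) (hq : IsFirst S q) (hp : IsLast S p)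
      (hs : ∃ i, S i = .star) (h : S p = .one) (hS' : S' = Function.update S p .star)
  | first (q p : Fin n) (hqp : q < p) (hq : IsFirst S q) (hp : IsLast S p)
      (hs : ∃ i, S i = .star) (h : S q = .zero) (hS' : S' = Function.update S q .star)
  | both (q p : Fin n) (hqp : q < p) (hq : IsFirst S q) (hp : IsLast S p)
      (hs : ∀ i, S i ≠ .star) (h0 : S q = .zero) (h1 : S p = .one)
      (hS' : S' = Function.update (Function.update S q .star) p .star)

/-- Collects what is needed to apply the reverse rule to `S'`: the move toggles `R`, keeps `L`
because `q < p`, and changes only the count of ones. -/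
theorem update_last {S S' : Word n} {q p : Fin n} (hqp : q < p) (hq : IsFirst S q)
    (hp : IsLast S p) (h : S p = .one) (hS' : S' = Function.update S p .star) :
    (OneRight S ∧ ¬ OneRight S' ∧ (ZeroLeft S' ↔ ZeroLeft S)) ∧
      (count S' .one + 1 = count S .one ∧ count S' .zero = count S .zero) ∧
      ReplaceRightmost .one .star S S' ∧ ReplaceRightmost .star .one S' S := by
  have hq' : IsFirst S' q := hq.congr (by rw [hS', Function.update_of_ne hqp.ne]; exact hq.1)
    fun i hi => by rw [hS', Function.update_of_ne (hi.trans hqp).ne]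
  have hp' : IsLast S' p := hp.congr (by rw [hS', Function.update_self]; simp)
    fun i hi => by rw [hS', Function.update_of_ne hi.ne']
  obtain ⟨c1, -, c3⟩ := count_update (b := .star) h (by simp)
  rw [← hS'] at c1 c3
  refine ⟨⟨hp.oneRight_iff.2 h, fun hr => ?_, ?_⟩, ⟨c1, c3 _ (by simp) (by simp)⟩,
    hp.replaceRightmost h hS', hp'.replaceRightmost (by rw [hS', Function.update_self]) ?_⟩
  · have := hp'.oneRight_iff.1 hr
    rw [hS', Function.update_self] at this
    cases this
  · rw [hq'.zeroLeft_iff, hq.zeroLeft_iff, hS', Function.update_of_ne hqp.ne]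
  · rw [hS', Function.update_idem, ← h, Function.update_eq_self]

theorem update_first {S S' : Word n} {q p : Fin n} (hqp : q < p) (hq : IsFirst S q)
    (hp : IsLast S p) (h : S q = .zero) (hS' : S' = Function.update S q .star) :
    (ZeroLeft S ∧ ¬ ZeroLeft S' ∧ (OneRight S' ↔ OneRight S)) ∧
      (count S' .zero + 1 = count S .zero ∧ count S' .one = count S .one) ∧
      ReplaceLeftmost .zero .star S S' ∧ ReplaceLeftmost .star .zero S' S := by
  have hq' : IsFirst S' q := hq.congr (by rw [hS', Function.update_self]; simp)
    fun i hi => by rw [hS', Function.update_of_ne hi.ne]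
  have hp' : IsLast S' p := hp.congr (by rw [hS', Function.update_of_ne hqp.ne']; exact hp.1)
    fun i hi => by rw [hS', Function.update_of_ne (hqp.trans hi).ne']
  obtain ⟨c1, -, c3⟩ := count_update (b := .star) h (by simp)
  rw [← hS'] at c1 c3
  refine ⟨⟨hq.zeroLeft_iff.2 h, fun hr => ?_, ?_⟩, ⟨c1, c3 _ (by simp) (by simp)⟩,
    hq.replaceLeftmost h hS', hq'.replaceLeftmost (by rw [hS', Function.update_self]) ?_⟩
  · have := hq'.zeroLeft_iff.1 hr
    rw [hS', Function.update_self] at this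
    cases this
  · rw [hp'.oneRight_iff, hp.oneRight_iff, hS', Function.update_of_ne hqp.ne']
  · rw [hS', Function.update_idem, ← h, Function.update_eq_self]

theorem update_both {S S' : Word n} {q p : Fin n} (hqp : q < p) (hq : IsFirst S q)
    (hp : IsLast S p) (h0 : S q = .zero) (h1 : S p = .one)
    (hS' : S' = Function.update (Function.update S q .star) p .star) :
    (¬ OneRight S' ∧ ¬ ZeroLeft S') ∧
      (count S' .zero + 1 = count S .zero ∧ count S' .one + 1 = count S .one) ∧
      (∃ T, ReplaceLeftmost .zero .star S T ∧ ReplaceRightmost .one .star T S') ∧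
      ∃ T, ReplaceLeftmost .star .zero S' T ∧ ReplaceRightmost .star .one T S := by
  set T := Function.update S q .star with hT
  have hqT : IsFirst T q := hq.congr (by rw [hT, Function.update_self]; simp)
    fun i hi => by rw [hT, Function.update_of_ne hi.ne]
  have hpT : IsLast T p := hp.congr (by rw [hT, Function.update_of_ne hqp.ne']; exact hp.1)
    fun i hi => by rw [hT, Function.update_of_ne (hqp.trans hi).ne']
  have hTp : T p = .one := by rw [hT, Function.update_of_ne hqp.ne', h1]
  obtain ⟨⟨-, a2, -⟩, ⟨a3, a4⟩, a5, -⟩ := update_first hqp hq hp h0 hT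
  obtain ⟨⟨-, b2, b2'⟩, ⟨b3, b4⟩, b5, -⟩ := update_last hqp hqT hpT hTp hS'
  refine ⟨⟨b2, fun h => a2 (b2'.1 h)⟩, ⟨by omega, by omega⟩, ⟨T, a5, b5⟩, ?_⟩
  -- The reverse move undoes the leftmost change first, so it passes through the other intermediate
  -- word; the two updates commute.
  set T' := Function.update S p .star with hT'
  have hqT' : IsFirst T' q := hq.congr (by rw [hT', Function.update_of_ne hqp.ne]; exact hq.1)
    fun i hi => by rw [hT', Function.update_of_ne (hi.trans hqp).ne]
  have hpT' : IsLast T' p := hp.congr (by rw [hT', Function.update_self]; simp)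
    fun i hi => by rw [hT', Function.update_of_ne hi.ne']
  have hTq : T' q = .zero := by rw [hT', Function.update_of_ne hqp.ne, h0]
  rw [hT, Function.update_comm hqp.ne] at hS'
  exact ⟨T', (update_first hqp hqT' hpT' hTq hS').2.2.2, (update_last hqp hq hp h1 hT').2.2.2⟩

theorem ReplaceRightmost.unique {S S' S'' : Word n} {a b : Letter}
    (h : ReplaceRightmost a b S S') (h' : ReplaceRightmost a b S S'') : S' = S'' := by
  obtain ⟨i, hi, rfl⟩ := h
  obtain ⟨j, hj, rfl⟩ := h'
  rw [hi.unique hj]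

theorem ReplaceLeftmost.unique {S S' S'' : Word n} {a b : Letter}
    (h : ReplaceLeftmost a b S S') (h' : ReplaceLeftmost a b S S'') : S' = S'' := by
  obtain ⟨i, hi, rfl⟩ := h
  obtain ⟨j, hj, rfl⟩ := h'
  rw [hi.unique hj]

/-- The hypotheses of distinct rules exclude each other. The bound `m₁ < k` is needed to separate
the rules for `S(1) = m₁` or `m₁ - 1` from those for `S(1) = k` or `k - 1`. -/
theorem Rule.unique {S S' S'' : Word n} (hm : m₁ < k) (h : Rule k m₀ m₁ S S')
    (h' : Rule k m₀ m₁ S S'') : S' = S'' := by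
  cases h <;> cases h' <;> first
    | exact ReplaceRightmost.unique ‹_› ‹_›
    | exact ReplaceLeftmost.unique ‹_› ‹_›
    | (exfalso; omega)
    | (exfalso; tauto)
    | (exfalso; grind)
    | skip
  · rename_i hS _ _ _ hS'
    obtain ⟨T, h1, h2⟩ := hS
    obtain ⟨T', h1', h2'⟩ := hS'
    obtain rfl := h1.unique h1'
    exact h2.unique h2'
  · rename_i hS _ _ _ _ hS'
    obtain ⟨T, h1, h2⟩ := hS
    obtain ⟨T', h1', h2'⟩ := hS'
    obtain rfl := h1.unique h1'
    exact h2.unique h2'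

theorem exists_star {S : Word n} (hS : IsFaceWord k S) (h : count S .one < k) :
    ∃ i, S i = .star := by
  refine exists_of_count_pos ?_
  have := count_add_count_add_count S
  rcases hS with h | h <;> omega

theorem exists_update_last_of_up {S S' : Word n} (hS : ∃ i, S i = .star) (hr : OneRight S)
    (h : ReplaceRightmost .one .star S S') : ∃ q p, q < p ∧ IsFirst S q ∧ IsLast S p ∧
      S p = .one ∧ S' = Function.update S p .star := by
  obtain ⟨p, hp, rfl⟩ := h
  obtain ⟨i, hi⟩ := hS
  have hp' := isLast_of_oneRight hr hp
  have hp1 : S p = .one := hp.1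
  obtain ⟨q, hq⟩ := exists_isFirst (show S i ≠ .one by simp [hi])
  have hip : i ≤ p := hp'.2 (show S i ≠ .zero by simp [hi])
  have hne : i ≠ p := by rintro rfl; rw [hi] at hp1; cases hp1
  exact ⟨q, p, (hq.2 (show S i ≠ .one by simp [hi])).trans_lt (lt_of_le_of_ne hip hne), hq, hp',
    hp1, rfl⟩

theorem exists_update_first_of_up {S S' : Word n} (hS : ∃ i, S i = .star) (hl : ZeroLeft S)
    (h : ReplaceLeftmost .zero .star S S') : ∃ q p, q < p ∧ IsFirst S q ∧ IsLast S p ∧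
      S q = .zero ∧ S' = Function.update S q .star := by
  obtain ⟨q, hq, rfl⟩ := h
  obtain ⟨i, hi⟩ := hS
  have hq' := isFirst_of_zeroLeft hl hq
  have hq0 : S q = .zero := hq.1
  obtain ⟨p, hp⟩ := exists_isLast (show S i ≠ .zero by simp [hi])
  have hip : q ≤ i := hq'.2 (show S i ≠ .one by simp [hi])
  have hne : q ≠ i := by rintro rfl; rw [hi] at hq0; cases hq0
  exact ⟨q, p, (lt_of_le_of_ne hip hne).trans_le (hp.2 (show S i ≠ .zero by simp [hi])), hq', hp,
    hq0, rfl⟩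

theorem exists_update_last_of_down {S S' : Word n} (hS : IsFaceWord k S) (hr : ¬ OneRight S)
    (h : ReplaceRightmost .star .one S S') : ∃ q p, q < p ∧ IsFirst S' q ∧ IsLast S' p ∧
      S' p = .one ∧ S = Function.update S' p .star ∧ ∃ i, S' i = .star := by
  obtain ⟨p, hp, rfl⟩ := h
  have hp' := isLast_of_not_oneRight hr hp
  have hp1 : S p = .star := hp.1
  obtain ⟨i, hi, hip⟩ := hS.exists_ne_star hp1
  obtain ⟨q, hq⟩ := exists_isFirst (show S i ≠ .one by simp [hi])
  have hip' : i < p := lt_of_le_of_ne (hp'.2 (show S i ≠ .zero by simp [hi])) hip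
  have hqp : q < p := (hq.2 (show S i ≠ .one by simp [hi])).trans_lt hip'
  refine ⟨q, p, hqp, hq.congr (by rw [Function.update_of_ne hqp.ne]; exact hq.1) fun j hj => ?_,
    hp'.congr (by simp) fun j hj => ?_, by simp, ?_, i, ?_⟩
  · rw [Function.update_of_ne (hj.trans hqp).ne]
  · rw [Function.update_of_ne hj.ne']
  · rw [Function.update_idem, ← hp1, Function.update_eq_self]
  · rw [Function.update_of_ne hip, hi]

theorem exists_update_first_of_down {S S' : Word n} (hS : IsFaceWord k S) (hl : ¬ ZeroLeft S)
    (h : ReplaceLeftmost .star .zero S S') : ∃ q p, q < p ∧ IsFirst S' q ∧ IsLast S' p ∧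
      S' q = .zero ∧ S = Function.update S' q .star ∧ ∃ i, S' i = .star := by
  obtain ⟨q, hq, rfl⟩ := h
  have hq' := isFirst_of_not_zeroLeft hl hq
  have hq1 : S q = .star := hq.1
  obtain ⟨i, hi, hip⟩ := hS.exists_ne_star hq1
  obtain ⟨p, hp⟩ := exists_isLast (show S i ≠ .zero by simp [hi])
  have hip' : q < i := lt_of_le_of_ne (hq'.2 (show S i ≠ .one by simp [hi])) hip.symm
  have hqp : q < p := hip'.trans_le (hp.2 (show S i ≠ .zero by simp [hi]))
  refine ⟨q, p, hqp, hq'.congr (by simp) fun j hj => ?_,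
    hp.congr (by rw [Function.update_of_ne hqp.ne']; exact hp.1) fun j hj => ?_, by simp, ?_, i, ?_⟩
  · rw [Function.update_of_ne hj.ne]
  · rw [Function.update_of_ne (hqp.trans hj).ne']
  · rw [Function.update_idem, ← hq1, Function.update_eq_self]
  · rw [Function.update_of_ne hip, hi]

theorem exists_update_both_of_up {S S' : Word n} (hs : ∀ i, S i ≠ .star)
    (h1 : count S .one = k) (hv : S ≠ v₀ n k)
    (h : ∃ T, ReplaceLeftmost .zero .star S T ∧ ReplaceRightmost .one .star T S') :
    ∃ q p, q < p ∧ IsFirst S q ∧ IsLast S p ∧ S q = .zero ∧ S p = .one ∧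
      S' = Function.update (Function.update S q .star) p .star := by
  obtain ⟨_, ⟨q, hq, rfl⟩, ⟨p, hp, rfl⟩⟩ := h
  have hq0 : S q = .zero := hq.1
  have hones : {j | Function.update S q .star j = .one} = {j | S j = .one} := by
    ext j
    by_cases hj : j = q
    · subst hj; simp [hq0]
    · simp [hj]
  rw [hones] at hp
  have hp1 : S p = .one := hp.1
  have hqf : IsFirst S q := by
    refine ⟨by simp [hq0], fun j hj => hq.2 ?_⟩
    cases h : S j with
    | zero => exact h
    | one => exact absurd h hj
    | star => exact absurd h (hs j)
  have hpl : IsLast S p := by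
    refine ⟨by simp [hp1], fun j hj => hp.2 ?_⟩
    cases h : S j with
    | zero => exact absurd h hj
    | one => exact h
    | star => exact absurd h (hs j)
  refine ⟨q, p, ?_, hqf, hpl, hq0, hp1, rfl⟩
  -- If the last `1` preceded the first `0`, the word would consist of `k` ones followed by zeros,
  -- that is, `v₀`.
  by_contra hqp
  have hpq : p < q := lt_of_le_of_ne (not_lt.1 hqp) (by
    rintro rfl; rw [hp1] at hq0; cases hq0)
  have hiff : ∀ i, S i = .one ↔ i < q := fun i =>
    ⟨fun hi => (hp.2 hi).trans_lt hpq, fun hi => hqf.eq_one hi⟩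
  have hqk : (q : ℕ) = k := by
    rw [← h1, count]
    have : {i | S i = .one} = ((Finset.Iio q : Finset (Fin n)) : Set (Fin n)) := by
      ext i
      simp [hiff]
    rw [this, ncard_coe_finset, Fin.card_Iio]
  refine hv (funext fun i => ?_)
  unfold v₀
  split_ifs with h
  · exact (hiff i).2 (by rw [Fin.lt_def]; omega)
  · cases h' : S i with
    | zero => rfl
    | one =>
      have := (hiff i).1 h'
      rw [Fin.lt_def] at this
      omega
    | star => exact absurd h' (hs i)

theorem exists_update_both_of_down {S S' : Word n} (hr : ¬ OneRight S) (hl : ¬ ZeroLeft S) (hc : count S .star = 2)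
    (h : ∃ T, ReplaceLeftmost .star .zero S T ∧ ReplaceRightmost .star .one T S') :
    ∃ q p, q < p ∧ IsFirst S' q ∧ IsLast S' p ∧ S' q = .zero ∧ S' p = .one ∧
      S = Function.update (Function.update S' q .star) p .star ∧ ∀ i, S' i ≠ .star := by
  obtain ⟨_, ⟨q, hq, rfl⟩, ⟨p, hp, rfl⟩⟩ := h
  have hqf := isFirst_of_not_zeroLeft hl hq
  have hqs : S q = .star := hq.1
  have hpq : p ≠ q := by
    rintro rfl
    have := hp.1
    simp at this
  have hps : S p = .star := by
    have := hp.1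
    simpa [hpq] using this
  have hpl : IsLast S p := by
    refine isLast_of_not_oneRight hr ⟨hps, fun j (hj : S j = .star) => ?_⟩
    by_cases hjq : j = q
    · subst hjq
      exact hq.2 hps
    · exact hp.2 (show Function.update S q .zero j = .star by rw [Function.update_of_ne hjq, hj])
  have hqp : q < p := lt_of_le_of_ne (hq.2 hps) hpq.symm
  have hS'q : Function.update (Function.update S q .zero) p .one q = .zero := by
    rw [Function.update_of_ne hpq.symm, Function.update_self]
  refine ⟨q, p, hqp, hqf.congr (by rw [hS'q]; simp) fun j hj => ?_,
    hpl.congr (by simp) fun j hj => ?_, hS'q, by simp, ?_, ?_⟩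
  · rw [Function.update_of_ne (hj.trans hqp).ne, Function.update_of_ne hj.ne]
  · rw [Function.update_of_ne hj.ne', Function.update_of_ne (hqp.trans hj).ne']
  · ext j
    by_cases hjp : j = p
    · subst hjp; simp [hps]
    by_cases hjq : j = q
    · subst hjq; simp [hqs, hjp]
    · simp [hjp, hjq]
  · have h2 : ({q, p} : Set (Fin n)) = stars S := by
      refine eq_of_subset_of_ncard_le (by rintro _ (rfl | rfl) <;> assumption) ?_
      rw [ncard_pair hpq.symm]
      exact hc.le
    intro j hj
    by_cases hjp : j = p
    · subst hjp; simp at hj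
    by_cases hjq : j = q
    · subst hjq; simp [hjp] at hj
    · have : j ∈ stars S := by simpa [stars, hjp, hjq] using hj
      rw [← h2] at this
      exact this.elim hjq hjp

/-- The rules define an involution whose pairs are related by `Up`. -/
theorem Rule.symm_and_up {S S' : Word n} (hm : m₁ < k) (hS : IsFaceWord k S)
    (h : Rule k m₀ m₁ S S') :
    Rule k m₀ m₁ S' S ∧ (Up S S' ∨ Up S' S) := by
  have hn := count_add_count_add_count S
  have hn' := count_add_count_add_count S'
  cases h with
  | r1 h hr hm hR =>
    have hst := exists_star hS h
    obtain ⟨q, p, hqp, hq, hp, h1, hu⟩ := exists_update_last_of_up hst hr hR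
    obtain ⟨⟨-, b2, b3⟩, ⟨c1, c2⟩, -, d⟩ := update_last hqp hq hp h1 hu
    refine ⟨.r2 (by omega) b2 ?_ d, Or.inl (.last q p hqp hq hp hst h1 hu)⟩
    rw [b3, c1, c2]
    exact hm
  | r2 h hr hm hR =>
    obtain ⟨q, p, hqp, hq, hp, h1, hu, hst⟩ := exists_update_last_of_down hS hr hR
    obtain ⟨⟨b1, b2, b3⟩, ⟨c1, c2⟩, d, -⟩ := update_last hqp hq hp h1 hu
    refine ⟨.r1 (by omega) b1 ?_ d, Or.inr (.last q p hqp hq hp hst h1 hu)⟩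
    rw [← b3, ← c1, ← c2]
    exact hm
  | r3 h h0 hr hl hR =>
    have hst := exists_star hS (by omega)
    obtain ⟨q, p, hqp, hq, hp, h1, hu⟩ := exists_update_first_of_up hst hl hR
    obtain ⟨⟨-, b2, b3⟩, ⟨c1, c2⟩, -, d⟩ := update_first hqp hq hp h1 hu
    exact ⟨.r4 (by omega) (by omega) (fun h => hr (b3.1 h)) b2 d,
      Or.inl (.first q p hqp hq hp hst h1 hu)⟩
  | r4 h h0 hr hl hR =>
    obtain ⟨q, p, hqp, hq, hp, h1, hu, hst⟩ := exists_update_first_of_down hS hl hR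
    obtain ⟨⟨b1, b2, b3⟩, ⟨c1, c2⟩, d, -⟩ := update_first hqp hq hp h1 hu
    exact ⟨.r3 (by omega) (by omega) (fun h => hr (b3.2 h)) b1 d,
      Or.inr (.first q p hqp hq hp hst h1 hu)⟩
  | r5 h h0 hr hl hR =>
    have hst := exists_star hS (by omega)
    obtain ⟨q, p, hqp, hq, hp, h1, hu⟩ := exists_update_first_of_up hst hl hR
    obtain ⟨⟨-, b2, b3⟩, ⟨c1, c2⟩, -, d⟩ := update_first hqp hq hp h1 hu
    exact ⟨.r6 (by omega) (by omega) (b3.2 hr) b2 d,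
      Or.inl (.first q p hqp hq hp hst h1 hu)⟩
  | r6 h h0 hr hl hR =>
    obtain ⟨q, p, hqp, hq, hp, h1, hu, hst⟩ := exists_update_first_of_down hS hl hR
    obtain ⟨⟨b1, b2, b3⟩, ⟨c1, c2⟩, d, -⟩ := update_first hqp hq hp h1 hu
    exact ⟨.r5 (by omega) (by omega) (b3.1 hr) b1 d,
      Or.inr (.first q p hqp hq hp hst h1 hu)⟩
  | r7 h h0 hr hl hR =>
    have hst := exists_star hS (by omega)
    obtain ⟨q, p, hqp, hq, hp, h1, hu⟩ := exists_update_first_of_up hst hl hR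
    obtain ⟨⟨-, b2, b3⟩, ⟨c1, c2⟩, -, d⟩ := update_first hqp hq hp h1 hu
    exact ⟨.r8 (by omega) (by omega) (fun h => hr (b3.1 h)) b2 d,
      Or.inl (.first q p hqp hq hp hst h1 hu)⟩
  | r8 h h0 hr hl hR =>
    obtain ⟨q, p, hqp, hq, hp, h1, hu, hst⟩ := exists_update_first_of_down hS hl hR
    obtain ⟨⟨b1, b2, b3⟩, ⟨c1, c2⟩, d, -⟩ := update_first hqp hq hp h1 hu
    exact ⟨.r7 (by omega) (by omega) (fun h => hr (b3.2 h)) b1 d,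
      Or.inr (.first q p hqp hq hp hst h1 hu)⟩
  | r9 h h0 hv hR =>
    have hst : ∀ i, S i ≠ .star := fun i hi => by
      have := hS.lt_of_star hi
      omega
    obtain ⟨q, p, hqp, hq, hp, h1, h2, hu⟩ := exists_update_both_of_up hst h hv hR
    obtain ⟨⟨b1, b2⟩, ⟨c1, c2⟩, -, d⟩ := update_both hqp hq hp h1 h2 hu
    exact ⟨.r10 (by omega) (by omega) b1 b2 d, Or.inl (.both q p hqp hq hp hst h1 h2 hu)⟩
  | r10 h h0 hr hl hR =>
    obtain ⟨q, p, hqp, hq, hp, h1, h2, hu, hst⟩ :=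
      exists_update_both_of_down hr hl (by omega) hR
    obtain ⟨⟨b1, b2⟩, ⟨c1, c2⟩, d, -⟩ := update_both hqp hq hp h1 h2 hu
    refine ⟨.r9 (by omega) (by omega) (fun hv => ?_) d,
      Or.inr (.both q p hqp hq hp hst h1 h2 hu)⟩
    rw [hv] at h1 h2
    unfold v₀ at h1 h2
    split_ifs at h1 h2 with e1 e2
    rw [Fin.lt_def] at hqp
    omega

/-! ### Acyclicity -/

theorem Up.exists_data {a b : Word n} (h : Up a b) : ∃ q p, q < p ∧ IsFirst a q ∧ IsLast a p ∧
    (∀ i, i ≠ q → i ≠ p → b i = a i) ∧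
    ((a p = .one ∧ b p = .star ∧ b q = a q ∧ ∃ i, a i = .star) ∨
      (a q = .zero ∧ b q = .star ∧ b p = a p ∧ ∃ i, a i = .star) ∨
      (a q = .zero ∧ a p = .one ∧ b q = .star ∧ b p = .star ∧ ∀ i, a i ≠ .star)) := by
  cases h with
  | last q p hqp hq hp hs h hS' =>
    subst hS'
    refine ⟨q, p, hqp, hq, hp, fun i _ hip => Function.update_of_ne hip _ _, Or.inl ⟨h, ?_, ?_, hs⟩⟩
    · simp
    · exact Function.update_of_ne hqp.ne _ _
  | first q p hqp hq hp hs h hS' =>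
    subst hS'
    refine ⟨q, p, hqp, hq, hp, fun i hiq _ => Function.update_of_ne hiq _ _,
      Or.inr (Or.inl ⟨h, ?_, ?_, hs⟩)⟩
    · simp
    · exact Function.update_of_ne hqp.ne' _ _
  | both q p hqp hq hp hs h0 h1 hS' =>
    subst hS'
    refine ⟨q, p, hqp, hq, hp, fun i hiq hip => ?_, Or.inr (Or.inr ⟨h0, h1, ?_, ?_, hs⟩)⟩
    · rw [Function.update_of_ne hip, Function.update_of_ne hiq]
    · rw [Function.update_of_ne hqp.ne, Function.update_self]
    · simp

theorem Up.refines {a b : Word n} (h : Up a b) : Refines a b := by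
  intro i hi
  obtain ⟨q, p, -, -, -, hoff, hcase⟩ := h.exists_data
  by_cases hiq : i = q
  · subst hiq
    rcases hcase with ⟨-, -, h, -⟩ | ⟨-, h, -⟩ | ⟨-, -, h, -⟩
    · exact h.symm
    · exact absurd h hi
    · exact absurd h hi
  by_cases hip : i = p
  · subst hip
    rcases hcase with ⟨-, h, -⟩ | ⟨-, -, h, -⟩ | ⟨-, -, -, h, -⟩
    · exact absurd h hi
    · exact h.symm
    · exact absurd h hi
  exact (hoff i hiq hip).symm

/-- In the case `both` two `*`s are added to a word without any, yet the dimension rises from `0` to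
`1`; the truncated formula covers this. The strict inequality records that the move is proper. -/
theorem Up.ncard_stars {a b : Word n} (ha : IsFaceWord k a) (h : Up a b) :
    (stars b).ncard - 1 = (stars a).ncard - 1 + 1 ∧ (stars a).ncard < (stars b).ncard := by
  obtain ⟨q, p, hqp, -, -, hoff, hcase⟩ := h.exists_data
  have h1 := ha.stars_ncard_ne_one
  have single : ∀ z, a z ≠ .star → b z = .star → (∀ i, i ≠ z → b i = a i) →
      (∃ i, a i = .star) → (stars b).ncard - 1 = (stars a).ncard - 1 + 1 ∧
        (stars a).ncard < (stars b).ncard := by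
    rintro z hz hbz hne ⟨i, hi⟩
    have hpos : 0 < (stars a).ncard := (ncard_pos).2 ⟨i, hi⟩
    have : stars b = insert z (stars a) := by
      ext j
      by_cases hj : j = z
      · subst hj; simpa [stars] using hbz
      · simp [stars, hj, hne j hj]
    rw [this, ncard_insert_of_notMem (show z ∉ stars a from hz)]
    omega
  rcases hcase with ⟨e1, e2, e3, e4⟩ | ⟨e1, e2, e3, e4⟩ | ⟨e1, e2, e3, e4, e5⟩
  · refine single p (by simp [e1]) e2 (fun i hi => ?_) e4
    by_cases hiq : i = q
    · rw [hiq, e3]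
    · exact hoff i hiq hi
  · refine single q (by simp [e1]) e2 (fun i hi => ?_) e4
    by_cases hip : i = p
    · rw [hip, e3]
    · exact hoff i hi hip
  · have ha0 : stars a = ∅ := eq_empty_of_forall_notMem e5
    have : stars b = {q, p} := by
      ext j
      by_cases hjq : j = q
      · subst hjq; simpa [stars] using e3
      by_cases hjp : j = p
      · subst hjp; simpa [stars] using e4
      simpa [stars, hjq, hjp, hoff j hjq hjp] using e5 j
    rw [this, ha0, ncard_pair hqp.ne, ncard_empty]
    omega

/-- The positions from the first letter other than `1` to the last letter other than `0`. -/
def spread (S : Word n) : Set (Fin n) :=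
  {i | (∃ j ≤ i, S j ≠ .one) ∧ ∃ j, i ≤ j ∧ S j ≠ .zero}

theorem spread_eq {S : Word n} {q p : Fin n} (hq : IsFirst S q) (hp : IsLast S p) :
    spread S = Icc q p := by
  ext i
  constructor
  · rintro ⟨⟨j, hj, hj'⟩, l, hl, hl'⟩
    exact ⟨(hq.2 hj').trans hj, hl.trans (hp.2 hl')⟩
  · rintro ⟨h1, h2⟩
    exact ⟨⟨q, h1, hq.1⟩, p, h2, hp.1⟩

/-- The first letter other than `1` and the last letter other than `0` are both different
from `*`. -/
def EndsFixed (S : Word n) : Prop :=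
  ∃ q p, IsFirst S q ∧ IsLast S p ∧ S q ≠ .star ∧ S p ≠ .star

theorem endsFixed_iff {S : Word n} {q p : Fin n} (hq : IsFirst S q) (hp : IsLast S p) :
    EndsFixed S ↔ S q ≠ .star ∧ S p ≠ .star := by
  constructor
  · rintro ⟨q', p', hq', hp', h⟩
    rwa [hq.unique hq', hp.unique hp']
  · exact fun h => ⟨q, p, hq, hp, h⟩

open Classical in
/-- A function that strictly decreases along gradient paths. -/
noncomputable def rank (S : Word n) : ℕ := 2 * (spread S).ncard + if EndsFixed S then 1 else 0

theorem rank_lt_of_ssubset {a a' : Word n} (h : spread a' ⊂ spread a) : rank a' < rank a := by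
  have := ncard_lt_ncard h
  unfold rank
  split_ifs <;> omega

theorem rank_lt_of_endsFixed {a a' : Word n} (h : spread a' = spread a) (h' : ¬ EndsFixed a')
    (ha : EndsFixed a) : rank a' < rank a := by
  unfold rank
  rw [h, if_neg h', if_pos ha]
  omega

/-- If `a` and `a'` have distinct partners `b` and `b'`, and `a'` is a facet of `b`, then `a'` has
smaller rank than `a`. -/
theorem rank_lt {a b a' b' : Word n} (ha : IsFaceWord k a)
    (hab : Up a b) (hab' : Up a' b') (hne : a' ≠ a) (hbb : b ≠ b')
    (href : Refines a' b) (hrk : (stars b).ncard - 1 = (stars a').ncard - 1 + 1) :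
    rank a' < rank a := by
  obtain ⟨q, p, hqp, hq, hp, hoff, hcase⟩ := hab.exists_data
  obtain ⟨q', p', hqp', hq', hp', hoff', hcase'⟩ := hab'.exists_data
  have hqb : IsFirst b q := hq.congr
    (by rcases hcase with ⟨-, -, h, -⟩ | ⟨-, h, -⟩ | ⟨-, -, h, -⟩
        · rw [h]; exact hq.1
        · rw [h]; simp
        · rw [h]; simp) fun i hi => hoff i hi.ne (hi.trans hqp).ne
  have hpb : IsLast b p := hp.congr
    (by rcases hcase with ⟨-, h, -⟩ | ⟨-, -, h, -⟩ | ⟨-, -, -, h, -⟩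
        · rw [h]; simp
        · rw [h]; exact hp.1
        · rw [h]; simp) fun i hi => hoff i (hqp.trans hi).ne' hi.ne'
  -- The word `b` has the same ends as `a`, and fixing `*`s of `b` can only move the ends inward. If
  -- one of them moves, the spread shrinks; otherwise the second part of the rank has to drop.
  have hqq : q ≤ q' := hqb.2 fun h => hq'.1 (by rw [href q' (by simp [h]), h])
  have hpp : p' ≤ p := hpb.2 fun h => hp'.1 (by rw [href p' (by simp [h]), h])
  by_cases heq : q' = q ∧ p' = p
  swap
  · refine rank_lt_of_ssubset ?_
    rw [spread_eq hq hp, spread_eq hq' hp']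
    refine ⟨Icc_subset_Icc hqq hpp, fun h => heq ?_⟩
    rw [Icc_subset_Icc_iff hqp.le] at h
    exact ⟨le_antisymm h.1 hqq, le_antisymm hpp h.2⟩
  obtain ⟨rfl, rfl⟩ := heq
  refine rank_lt_of_endsFixed ?_ ?_ ?_
  · rw [spread_eq hq hp, spread_eq hq' hp']
  all_goals
    rw [endsFixed_iff (by assumption) (by assumption)]
  all_goals
    have hext : a' q' = a q' → a' p' = a p' →
        (∀ i, i ≠ q' → i ≠ p' → b i = .star → a' i = .star) → False := by
      intro h1 h2 h3
      refine hne (funext fun i => ?_)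
      by_cases hiq : i = q'
      · rw [hiq, h1]
      by_cases hip : i = p'
      · rw [hip, h2]
      by_cases hs : b i = .star
      · rw [h3 i hiq hip hs, ← hoff i hiq hip, hs]
      · rw [href i hs, hoff i hiq hip]
    -- When `a` has a `*`, its partner has positive dimension plus one, so the facet `a'` fixes
    -- exactly one `*` of `b`.
    have hF : (∃ i, a i = .star) →
        ∀ z w, b z = .star → b w = .star → a' z ≠ .star → a' w ≠ .star → z = w := by
      rintro ⟨i, hi⟩ z w hz hw hz' hw'
      have h1 : 0 < (stars a).ncard := (ncard_pos).2 ⟨i, hi⟩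
      have h2 := ha.stars_ncard_ne_one
      have h3 := hab.ncard_stars ha
      have h4 : (stars b \ stars a').ncard = 1 := by
        rw [ncard_sdiff href.stars_subset]
        omega
      exact (ncard_le_one).1 h4.le z ⟨hz, hz'⟩ w ⟨hw, hw'⟩
  -- An end letter other than `*` is forced: `0` at `q'` and `1` at `p'`. If both ends of `a'` were
  -- fixed, `a'` would restore the very letters that `b` freed, and so equal `a`.
  · rintro ⟨s1, s2⟩
    rcases hcase with ⟨e1, e2, e3, e4⟩ | ⟨e1, e2, e3, e4⟩ | ⟨e1, e2, e3, e4, e5⟩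
    · have hp1 : a' p' = a p' := by
        rw [e1]
        have := hp'.1
        cases h : a' p' with
        | zero => exact absurd h this
        | one => rfl
        | star => exact absurd h s2
      by_cases hbq : b q' = .star
      · exact hqp.ne (hF e4 _ _ hbq e2 s1 s2)
      · refine hext (by rw [← e3]; exact href _ hbq) hp1 fun i _ hip hs => ?_
        by_contra hs'
        exact hip (hF e4 _ _ hs e2 hs' s2)
    · have hq1 : a' q' = a q' := by
        rw [e1]
        have := hq'.1
        cases h : a' q' with
        | zero => rfl
        | one => exact absurd h this
        | star => exact absurd h s1
      by_cases hbp : b p' = .star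
      · exact hqp.ne (hF e4 _ _ e2 hbp s1 s2)
      · refine hext hq1 (by rw [← e3]; exact href _ hbp) fun i hiq _ hs => ?_
        by_contra hs'
        exact hiq (hF e4 _ _ hs e2 hs' s1)
    · have hp1 : a' p' = a p' := by
        rw [e2]
        have := hp'.1
        cases h : a' p' with
        | zero => exact absurd h this
        | one => rfl
        | star => exact absurd h s2
      have hq1 : a' q' = a q' := by
        rw [e1]
        have := hq'.1
        cases h : a' q' with
        | zero => rfl
        | one => exact absurd h this
        | star => exact absurd h s1
      refine hext hq1 hp1 fun i hiq hip hs => ?_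
      rw [hoff i hiq hip] at hs
      exact absurd hs (e5 i)
  · -- if one of the ends of `a` is a `*`, then both ends of `b` are
    have hboth : b q' = .star → b p' = .star → (∃ i, a i = .star) →
        (a q' = .zero ∧ a p' = .star ∨ a q' = .star ∧ a p' = .one) → False := by
      intro bq bp hs hends
      -- If `a'` fixes an end `z`, that is the only `*` of `b` it fixes. So `b'` agrees with `b`
      -- away from the ends, and two `*`s at the ends of `b'` would give `b = b'`. The cases below
      -- show that the move from `a'` to `b'` does produce them.
      have hbb' : ∀ z, (z = q' ∨ z = p') → a' z ≠ .star → b' q' = .star → b' p' = .star →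
          False := by
        intro z hz hzs c1 c2
        refine hbb (funext fun i => ?_)
        by_cases hiq : i = q'
        · rw [hiq, bq, c1]
        by_cases hip : i = p'
        · rw [hip, bp, c2]
        rw [hoff' i hiq hip]
        by_cases hbs : b i = .star
        · rw [hbs]
          by_contra hs'
          have hbz : b z = .star := by rcases hz with rfl | rfl <;> assumption
          have := hF hs i z hbs hbz (fun h => hs' h.symm) hzs
          rcases hz with rfl | rfl
          · exact hiq this
          · exact hip this
        · exact (href i hbs).symm
      have hF' := hF hs q' p' bq bp
      have hqp0 := hqp.ne
      rcases hcase' with ⟨d1, d2, d3, d4⟩ | ⟨d1, d2, d3, d4⟩ | ⟨d1, d2, d3, d4, d5⟩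
      · have hq0 : a' q' = .star := by
          by_contra hn
          exact hqp0 (hF' hn (by simp [d1]))
        exact hbb' p' (Or.inr rfl) (by simp [d1]) (d3.trans hq0) d2
      · have hp0 : a' p' = .star := by
          by_contra hn
          exact hqp0 (hF' (by simp [d1]) hn)
        exact hbb' q' (Or.inl rfl) (by simp [d1]) d2 (d3.trans hp0)
      · exact hqp0 (hF' (by simp [d1]) (by simp [d2]))
    rcases hcase with ⟨e1, e2, e3, e4⟩ | ⟨e1, e2, e3, e4⟩ | ⟨e1, e2, -, -, -⟩
    · refine ⟨fun h => hboth (e3.trans h) e2 e4 (Or.inr ⟨h, e1⟩), by simp [e1]⟩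
    · refine ⟨by simp [e1], fun h => hboth e2 (e3.trans h) e4 (Or.inl ⟨e1, h⟩)⟩
    · simp [e1, e2]

/-! ### The vertex `v₀` -/

/-- The vertex `v₀`, as a point. -/
noncomputable def basePoint (n k : ℕ) : Fin n → ℝ := point {i : Fin n | (i : ℕ) < k}

theorem basePoint_mem (hkn : k < n) : basePoint n k ∈ points n k := by
  refine point_mem_points ?_
  have : {i : Fin n | (i : ℕ) < k} = ((Finset.Iio ⟨k, hkn⟩ : Finset (Fin n)) : Set (Fin n)) := by
    ext i
    simp [Fin.lt_def]
  rw [this, ncard_coe_finset, Fin.card_Iio]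

theorem v₀_eq_wordOf : v₀ n k = wordOf (basePoint n k) := by
  ext i
  by_cases h : (i : ℕ) < k <;> simp [v₀, wordOf, basePoint, point, h]

theorem isFaceWord_v₀ (hkn : k < n) : IsFaceWord k (v₀ n k) := by
  rw [v₀_eq_wordOf]
  exact isFaceWord_wordOf (basePoint_mem hkn)

theorem face_v₀ (hkn : k < n) : face k (v₀ n k) = {basePoint n k} := by
  rw [v₀_eq_wordOf, face_wordOf (basePoint_mem hkn)]

theorem exists_perm {x y : Fin n → ℝ} (hx : x ∈ points n k) (hy : y ∈ points n k) :
    ∃ g : Equiv.Perm (Fin n), x ∘ g = y := by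
  classical
  have hcard : Fintype.card {i // y i = 1} = Fintype.card {i // x i = 1} := by
    rw [← Nat.card_eq_fintype_card, ← Nat.card_eq_fintype_card]
    exact (Nat.card_coe_set_eq {i | y i = 1}).trans
      ((ncard_ones hy).trans ((ncard_ones hx).symm.trans (Nat.card_coe_set_eq {i | x i = 1}).symm))
  let e := Fintype.equivOfCardEq hcard
  refine ⟨e.extendSubtype, funext fun i => ?_⟩
  by_cases h : y i = 1
  · exact (e.extendSubtype_mem i h).trans h.symm
  · have h1 : x (e.extendSubtype i) ≠ 1 := e.extendSubtype_not_mem i h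
    exact ((hx.1 _).resolve_right h1).trans ((hy.1 _).resolve_right h).symm

/-- A nonempty subcomplex contains a vertex, and the symmetric group acts transitively on the
vertices. -/
theorem face_v₀_mem (hk : 1 ≤ k) (hkn : k < n) (hK : IsSubcomplex (J n k) K)
    (hinv : IsInvariant K) (hne : K.Nonempty) : face k (v₀ n k) ∈ K := by
  obtain ⟨F, hF⟩ := hne
  obtain ⟨S, hS, rfl⟩ := IsFace.exists_word hk hkn (hK.isFace F hF)
  obtain ⟨x, hx⟩ := hS.verts_nonempty
  have hxK : {x} ∈ K := by
    rw [← face_wordOf hx.1]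
    refine hK.down_closed _ hF _ (isFaceWord_wordOf hx.1).isFace ?_
    rw [face_wordOf hx.1, singleton_subset_iff]
    exact subset_convexHull ℝ _ hx
  obtain ⟨g, hg⟩ := exists_perm hx.1 (basePoint_mem hkn)
  have := hinv g _ hxK
  rwa [image_singleton, hg, ← face_v₀ hkn] at this

/-! ### The matching -/

theorem IsCanonical.lt (hk : 1 ≤ k) (h : IsCanonical k K m₀ m₁) : m₁ < k := by
  rcases h with ⟨-, -, h⟩ | ⟨-, h, -⟩
  · omega
  · exact h.1.1

theorem MatchedWith.symm {F G : Set (Fin n → ℝ)} (hm : m₁ < k) (h : MatchedWith k m₀ m₁ F G) :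
    MatchedWith k m₀ m₁ G F := by
  obtain ⟨S, S', hS, hS', rfl, rfl, hR⟩ := h
  exact ⟨S', S, hS', hS, rfl, rfl, (hR.symm_and_up hm hS).1⟩

theorem MatchedWith.unique {F G G' : Set (Fin n → ℝ)} (hm : m₁ < k)
    (h : MatchedWith k m₀ m₁ F G) (h' : MatchedWith k m₀ m₁ F G') : G = G' := by
  obtain ⟨S, S', hS, hS', rfl, rfl, hR⟩ := h
  obtain ⟨T, T', hT, hT', hST, rfl, hR'⟩ := h'
  obtain rfl := face_injective hS hT hST
  rw [hR.unique hm hR']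

/-- A word with `k` ones can only be subject to `r9`, as `m₁ < k`, and `r9` excludes `v₀`. So
pairing `v₀` with `∅` creates no conflict. -/
theorem not_rule_v₀ (hkn : k < n) (hm : m₁ < k) {S : Word n} : ¬ Rule k m₀ m₁ (v₀ n k) S := by
  have h : count (v₀ n k) .one = k := by
    rw [v₀_eq_wordOf, count_one_wordOf (basePoint_mem hkn)]
  intro hR
  cases hR <;> first | omega | contradiction

theorem not_matchedWith_v₀ (hkn : k < n) (hm : m₁ < k) (G : Set (Fin n → ℝ)) :
    ¬ MatchedWith k m₀ m₁ (face k (v₀ n k)) G := by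
  rintro ⟨S, S', hS, -, h, -, hR⟩
  obtain rfl := face_injective (isFaceWord_v₀ hkn) hS h
  exact not_rule_v₀ hkn hm hR

/-- `F` is matched with `G`, and `F` is the smaller one of the two. -/
def MatchedUp (k m₀ m₁ : ℕ) (F G : Set (Fin n → ℝ)) : Prop :=
  ∃ S S' : Word n, IsFaceWord k S ∧ IsFaceWord k S' ∧ F = face k S ∧ G = face k S' ∧
    Rule k m₀ m₁ S S' ∧ Up S S'

theorem MatchedUp.matchedWith {F G : Set (Fin n → ℝ)} (h : MatchedUp k m₀ m₁ F G) :
    MatchedWith k m₀ m₁ F G := by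
  obtain ⟨S, S', h1, h2, h3, h4, h5, -⟩ := h
  exact ⟨S, S', h1, h2, h3, h4, h5⟩

theorem MatchedWith.matchedUp {F G : Set (Fin n → ℝ)} (hm : m₁ < k)
    (h : MatchedWith k m₀ m₁ F G) : MatchedUp k m₀ m₁ F G ∨ MatchedUp k m₀ m₁ G F := by
  obtain ⟨S, S', h1, h2, h3, h4, h5⟩ := h
  obtain ⟨h6, h7 | h7⟩ := h5.symm_and_up hm h1
  · exact Or.inl ⟨S, S', h1, h2, h3, h4, h5, h7⟩
  · exact Or.inr ⟨S', S, h2, h1, h4, h3, h6, h7⟩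

theorem MatchedUp.ssubset {F G : Set (Fin n → ℝ)} (h : MatchedUp k m₀ m₁ F G) :
    F ⊂ G ∧ F.Nonempty ∧
      finrank ℝ (vectorSpan ℝ G) = finrank ℝ (vectorSpan ℝ F) + 1 := by
  obtain ⟨S, S', hS, hS', rfl, rfl, -, hup⟩ := h
  have hc := hup.ncard_stars hS
  rw [face_ssubset_iff hS hS', finrank_face hS, finrank_face hS']
  refine ⟨⟨hup.refines, ?_⟩, hS.face_nonempty, hc.1⟩
  rintro rfl
  exact lt_irrefl _ hc.2

/-- The cells matched with a larger cell. -/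
def lower (k m₀ m₁ : ℕ) (K : Set (Set (Fin n → ℝ))) : Set (Set (Fin n → ℝ)) :=
  insert ∅ {F ∈ K | ∃ G ∈ K, MatchedUp k m₀ m₁ F G}

/-- The cells matched with a smaller cell. -/
def upper (k m₀ m₁ : ℕ) (K : Set (Set (Fin n → ℝ))) : Set (Set (Fin n → ℝ)) :=
  insert (face k (v₀ n k)) {G ∈ K | ∃ F ∈ K, MatchedUp k m₀ m₁ F G}

open Classical in
/-- The larger cell with which a cell is matched. -/
noncomputable def partner (k m₀ m₁ : ℕ) (F : Set (Fin n → ℝ)) : Set (Fin n → ℝ) :=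
  -- The default value is the one wanted for `∅`, which no rule matches.
  if h : ∃ G, MatchedUp k m₀ m₁ F G then h.choose else face k (v₀ n k)

theorem partner_eq {F G : Set (Fin n → ℝ)} (hm : m₁ < k) (h : MatchedUp k m₀ m₁ F G) :
    partner k m₀ m₁ F = G := by
  have h' : ∃ G, MatchedUp k m₀ m₁ F G := ⟨G, h⟩
  rw [partner, dif_pos h']
  exact h'.choose_spec.matchedWith.unique hm h.matchedWith

theorem partner_empty : partner k m₀ m₁ (∅ : Set (Fin n → ℝ)) = face k (v₀ n k) :=
  dif_neg fun ⟨_, h⟩ => Set.not_nonempty_empty h.ssubset.2.1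

open Classical in
/-- The rank of the word of a face. -/
noncomputable def faceRank (k : ℕ) (F : Set (Fin n → ℝ)) : ℕ :=
  if h : ∃ S : Word n, IsFaceWord k S ∧ F = face k S then rank h.choose else 0

theorem faceRank_face {S : Word n} (hS : IsFaceWord k S) : faceRank k (face k S) = rank S := by
  have h : ∃ T : Word n, IsFaceWord k T ∧ face k S = face k T := ⟨S, hS, rfl⟩
  rw [faceRank, dif_pos h]
  exact congrArg rank (face_injective hS h.choose_spec.1 h.choose_spec.2).symm

theorem isAcyclicMatching (hkn : k < n) (hK : IsSubcomplex (J n k) K)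
    (hv : face k (v₀ n k) ∈ K) (hm : m₁ < k) (o : Orientations (Fin n → ℝ)) :
    IsAcyclicMatching o K (lower k m₀ m₁ K) (upper k m₀ m₁ K) (partner k m₀ m₁)
      (faceRank k) := by
  have hv0 : finrank ℝ (vectorSpan ℝ (face k (v₀ n k))) = 0 := by
    rw [face_v₀ hkn, vectorSpan_singleton]; simp
  have hvd : dim (face k (v₀ n k)) = 0 := by
    rw [dim_of_nonempty (isFaceWord_v₀ hkn).face_nonempty, hv0]; rfl
  have hnv : ∀ F, ¬ MatchedUp k m₀ m₁ F (face k (v₀ n k)) := fun F h =>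
    not_matchedWith_v₀ hkn hm _ (h.matchedWith.symm hm)
  refine ⟨?_, ?_, ?_, ⟨?_, ?_, ?_⟩, ?_, ?_, ?_⟩
  · exact insert_subset_insert (sep_subset _ _)
  · rintro G (rfl | hG)
    · exact mem_insert_of_mem _ hv
    · exact mem_insert_of_mem _ hG.1
  · rw [Set.disjoint_left]
    rintro F (rfl | ⟨-, G, -, hFG⟩) (hF | ⟨-, G', -, hGF⟩)
    · exact (isFaceWord_v₀ hkn).face_nonempty.ne_empty hF.symm
    · exact hGF.ssubset.1.not_subset (empty_subset _)
    · rw [hF] at hFG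
      exact not_matchedWith_v₀ hkn hm _ hFG.matchedWith
    · obtain rfl := hFG.matchedWith.unique hm (hGF.matchedWith.symm hm)
      exact lt_irrefl _ (hFG.ssubset.1.trans hGF.ssubset.1)
  · rintro F (rfl | ⟨hF, G, hG, h⟩)
    · rw [partner_empty]
      exact mem_insert _ _
    · rw [partner_eq hm h]
      exact Or.inr ⟨hG, F, hF, h⟩
  · rintro F (rfl | ⟨hF, G, hG, h⟩) F' (rfl | ⟨hF', G', hG', h'⟩) heq
    · rfl
    · rw [partner_empty, partner_eq hm h'] at heq
      rw [← heq] at h'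
      exact absurd h' (hnv _)
    · rw [partner_empty, partner_eq hm h] at heq
      rw [heq] at h
      exact absurd h (hnv _)
    · rw [partner_eq hm h, partner_eq hm h'] at heq
      subst heq
      exact (h.matchedWith.symm hm).unique hm (h'.matchedWith.symm hm)
  · rintro G (rfl | ⟨hG, F, hF, h⟩)
    · exact ⟨∅, mem_insert _ _, partner_empty⟩
    · exact ⟨F, Or.inr ⟨hF, G, hG, h⟩, partner_eq hm h⟩
  · rintro F (rfl | ⟨hF, G, hG, h⟩)
    · rw [partner_empty, hvd, dim_empty]; rfl
    · rw [partner_eq hm h]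
      obtain ⟨h1, h2, h3⟩ := h.ssubset
      rw [dim_of_nonempty h2, dim_of_nonempty (h2.mono h1.subset), h3]
      push_cast
      rfl
  · rintro F (rfl | ⟨hF, G, hG, h⟩)
    · rw [partner_empty, incidence_empty o hvd]; rfl
    · rw [partner_eq hm h]
      obtain ⟨h1, h2, h3⟩ := h.ssubset
      obtain ⟨f, hf⟩ := exists_supports (hK.isFace _ hF) (hK.isFace _ hG)
      exact incidence_mul_self o hf h1 h2 h3
  -- The pair of `∅` and `v₀` takes part in no longer gradient path: `∅` is the only cell below
  -- `v₀`, and the partner of a nonempty face has positive dimension, so `∅` is not among its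
  -- facets.
  · rintro F (rfl | ⟨hF, G, hG, h⟩) F' (rfl | ⟨hF', G', hG', h'⟩) hne hinc
    · exact absurd rfl hne
    · rw [partner_empty] at hinc
      rcases of_incidence_ne_zero o hinc with ⟨-, -, h1⟩ | ⟨h1, -⟩
      · omega
      · exact absurd h1 h'.ssubset.2.1.ne_empty
    · rw [partner_eq hm h] at hinc
      obtain ⟨e1, e2, e3⟩ := h.ssubset
      rcases of_incidence_ne_zero o hinc with ⟨-, h1, -⟩ | ⟨-, h1⟩
      · exact absurd h1 Set.not_nonempty_empty
      · rw [dim_of_nonempty (e2.mono e1.subset)] at h1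
        omega
    · rw [partner_eq hm h] at hinc
      rcases of_incidence_ne_zero o hinc with ⟨h1, h2, h3⟩ | ⟨h1, -⟩
      swap
      · exact absurd h1 h'.ssubset.2.1.ne_empty
      have hGG : G ≠ G' := by
        rintro rfl
        exact hne ((h'.matchedWith.symm hm).unique hm (h.matchedWith.symm hm))
      obtain ⟨a, b, ha, hb, rfl, rfl, -, hab⟩ := h
      obtain ⟨a', b', ha', hb', rfl, rfl, -, hab'⟩ := h'
      rw [finrank_face hb, finrank_face ha'] at h3
      rw [faceRank_face ha, faceRank_face ha']
      exact rank_lt ha hab hab' (fun h => hne (h ▸ rfl)) (fun h => hGG (h ▸ rfl))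
        ((face_ssubset_iff ha' hb).1 h1).1 h3

/-- A face whose partner lies outside `K` counts as unmatched, in agreement with `lower` and
`upper`, which ask for both members of a pair to be in `K`. -/
theorem mem_unmatched_iff (hK : IsSubcomplex (J n k) K) (hm : m₁ < k)
    (F : Set (Fin n → ℝ)) : F ∈ unmatched k m₀ m₁ K ↔
      F ∈ insert ∅ K ∧ F ∉ lower k m₀ m₁ K ∪ upper k m₀ m₁ K := by
  constructor
  · rintro ⟨hF, hv, hn⟩
    refine ⟨mem_insert_of_mem _ hF, ?_⟩
    rintro ((rfl | ⟨-, G, hG, h⟩) | (h | ⟨-, G, hG, h⟩))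
    · exact Set.not_nonempty_empty (hK.isFace _ hF).1
    · exact hn G hG h.matchedWith
    · exact hv h
    · exact hn G hG (h.matchedWith.symm hm)
  · rintro ⟨hF, hn⟩
    have hFK : F ∈ K := hF.resolve_left fun h => hn (Or.inl (Or.inl h))
    refine ⟨hFK, fun h => hn (Or.inr (Or.inl h)), fun G hG h => hn ?_⟩
    rcases h.matchedUp hm with h | h
    · exact Or.inl (Or.inr ⟨hFK, G, hG, h⟩)
    · exact Or.inr (Or.inr ⟨hFK, G, hG, h⟩)

end Hypersimplex

theorem mainTheorem4 (n k : ℕ) (hk : 1 ≤ k) (hkn : k < n)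
    (K : Set (Set (Fin n → ℝ)))
    (hK : FaceComplex.IsSubcomplex (Hypersimplex.J n k) K) (hinv : Hypersimplex.IsInvariant K)
    (m₀ m₁ : ℕ) (hm : Hypersimplex.IsCanonical k K m₀ m₁)
    (d : ℕ) (hd : Hypersimplex.UnmatchedInSingleDim k m₀ m₁ K d)
    (o : FaceComplex.Orientations (Fin n → ℝ)) :
    FaceComplex.HomologyConcentratedIn o K d ∧
    (0 < d → Nonempty (FaceComplex.ReducedHomology o K d ≃+
      (Fin (Hypersimplex.unmatched k m₀ m₁ K).ncard → ℤ))) := by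
  obtain ⟨hne, hdim⟩ := hd
  have hlt := hm.lt hk
  have hv := Hypersimplex.face_v₀_mem hk hkn hK hinv (hne.mono (sep_subset _ _))
  have hfin := Hypersimplex.finite_cell hK
  have h := (Hypersimplex.isAcyclicMatching (m₀ := m₀) hkn hK hv hlt o).homologyConcentratedIn hfin
    (FaceComplex.boundary_boundary o hK (Hypersimplex.isThin hk hkn hK) hfin)
    (Hypersimplex.mem_unmatched_iff hK hlt) hne hdim
  exact ⟨h.1, fun _ => h.2⟩
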